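/- Let $(M,g)$ be a smooth pseudo-Riemannian manifold with Levi-Civita connection $\nabla$, and write $\langle\cdot,\cdot\rangle$ for $g$. For a smooth non-degenerate distribution $E\subseteq TM$ of rank $m$, with splitting $TM=E\oplus E^{\perp}$, put $s^{E}(X,Y)=(\nabla_XY)^{E^{\perp}}$ and $h^{E}(X,Y)=\tfrac12(\nabla_XY+\nabla_YX)^{E^{\perp}}$ for sections $X,Y$ of $E$, and let $H_E=\tfrac1m\operatorname{tr}_g h^{E}$ be the mean curvature normal. Call $E$ \emph{geodesic} if $s^{E}=0$; \emph{umbilical} if $s^{E}(X,Y)=\langle X,Y\rangle H_E$ for all sections $X,Y$ of $E$; \emph{spherical} if it is umbilical and $(\nabla_XH_E)^{E^{\perp}}=0$ for all sections $X$ of $E$; and \emph{Killing} if it is spherical and $E^{\perp}$ is geodesic. Let $T$ be a smooth symmetric tensor field of valence two that is a conformal Killing tensor, i.e. $\nabla_{(i}T_{jk)}=t_{(i}g_{jk)}$ for some smooth vector field $t$. Suppose that the endomorphism field associated with $T$ is pointwise diagonalizable over $\mathbb{R}$, with pointwise distinct eigenfunctions $\lambda_1,\dots,\lambda_k$ whose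 eigenspaces $E_i=\ker(T-\lambda_i I)\neq 0$ are smooth distributions (so that $TM=E_1\oplus\dots\oplus E_k$ is an orthogonal direct sum of non-degenerate distributions). Suppose further that $(E_i)_{i=1}^{k}$ is orthogonally integrable: every point has a neighbourhood diffeomorphic to a product $M_1\times\dots\times M_k$ in such a way that for each $i$ the slices in the direction of $M_i$ are integral manifolds of $E_i$. If, for some $i$, the distribution $E_i^{\perp}$ is geodesic, then $E_i$ is spherical, and hence Killing. -/

import Mathlib

open Bundle FiberBundle VectorField
open scoped Manifold ContDiff

noncomputable section

namespace PseudoRiemannian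

variable {V : Type*} [NormedAddCommGroup V] [NormedSpace ℝ V]
  {M : Type*} [TopologicalSpace M] [ChartedSpace V M]

/-- A smooth pseudo-Riemannian metric on the tangent bundle of `M`: a smooth field of symmetric
non-degenerate bilinear forms (of arbitrary signature). -/
structure Metric (V : Type*) [NormedAddCommGroup V] [NormedSpace ℝ V]
    (M : Type*) [TopologicalSpace M] [ChartedSpace V M] [IsManifold 𝓘(ℝ, V) ∞ M] where
  inner (x : M) : TangentSpace 𝓘(ℝ, V) x →L[ℝ] TangentSpace 𝓘(ℝ, V) x →L[ℝ] ℝ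
  symm (x : M) (v w : TangentSpace 𝓘(ℝ, V) x) : inner x v w = inner x w v
  nondegenerate (x : M) (v : TangentSpace 𝓘(ℝ, V) x) (hv : ∀ w, inner x v w = 0) : v = 0
  contMDiff : ContMDiff 𝓘(ℝ, V) (𝓘(ℝ, V).prod 𝓘(ℝ, V →L[ℝ] V →L[ℝ] ℝ)) ∞
    (fun x ↦ TotalSpace.mk' (V →L[ℝ] V →L[ℝ] ℝ) x (inner x))

/-! ### The Levi-Civita connection -/

section LeviCivita

variable [IsManifold 𝓘(ℝ, V) ∞ M] (g : Metric V M)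

theorem Metric.mdifferentiableAt_inner {X Y : Π x : M, TangentSpace 𝓘(ℝ, V) x} {x : M}
    (hX : MDiffAt (T% X) x) (hY : MDiffAt (T% Y) x) :
    MDiffAt (fun y ↦ g.inner y (X y) (Y y)) x := by
  have : MDifferentiableAt 𝓘(ℝ, V) (𝓘(ℝ, V).prod 𝓘(ℝ))
      (fun m ↦ TotalSpace.mk' ℝ (E := Trivial M ℝ) m (g.inner m (X m) (Y m))) x := by
    apply MDifferentiableAt.clm_bundle_apply₂ (F₁ := V) (F₂ := V)
    · exact g.contMDiff.mdifferentiableAt (by simp)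
    · exact hX
    · exact hY
  simp only [mdifferentiableAt_totalSpace] at this
  exact this.2

/-- Half of the right-hand side of the Koszul formula
`2⟨∇_X Y, Z⟩ = X⟨Y,Z⟩ + Y⟨Z,X⟩ - Z⟨X,Y⟩ + ⟨[X,Y],Z⟩ - ⟨[X,Z],Y⟩ - ⟨[Y,Z],X⟩`. -/
def Metric.koszul (Y X Z : Π x : M, TangentSpace 𝓘(ℝ, V) x) (x : M) : ℝ :=
  (1 / 2 : ℝ) *
    (d% (fun y ↦ g.inner y (Y y) (Z y)) x (X x)
      + d% (fun y ↦ g.inner y (Z y) (X y)) x (Y x)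
      - d% (fun y ↦ g.inner y (X y) (Y y)) x (Z x)
      + g.inner x (mlieBracket 𝓘(ℝ, V) X Y x) (Z x)
      - g.inner x (mlieBracket 𝓘(ℝ, V) X Z x) (Y x)
      - g.inner x (mlieBracket 𝓘(ℝ, V) Y Z x) (X x))

theorem Metric.ext_inner {x : M} {v v' : TangentSpace 𝓘(ℝ, V) x}
    (h : ∀ Z : Π x : M, TangentSpace 𝓘(ℝ, V) x, MDiffAt (T% Z) x →
      g.inner x v (Z x) = g.inner x v' (Z x)) : v = v' := by
  rw [← sub_eq_zero]
  refine g.nondegenerate x _ fun w ↦ ?_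
  have := h (extend V w) (mdifferentiableAt_extend ..)
  simp only [extend_apply_self] at this
  simp [this]

variable [FiniteDimensional ℝ V]

theorem Metric.koszul_tensorial₁ {x : M} {Y Z : Π x : M, TangentSpace 𝓘(ℝ, V) x}
    (hY : MDiffAt (T% Y) x) (hZ : MDiffAt (T% Z) x) :
    TensorialAt 𝓘(ℝ, V) V (fun X ↦ g.koszul Y X Z x) x where
  smul {f X} hf hX := by
    have : CompleteSpace V := FiniteDimensional.complete ℝ V
    have h1 := mvfderiv_fun_mul hf (g.mdifferentiableAt_inner hZ hX)
    have h2 := mvfderiv_fun_mul hf (g.mdifferentiableAt_inner hX hY)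
    simp [Metric.koszul, h1, h2, mlieBracket_smul_left hf hX]
    rw [g.symm x (X x) (Z x), g.symm x (X x) (Y x)]
    ring
  add {X X'} hX hX' := by
    have : CompleteSpace V := FiniteDimensional.complete ℝ V
    have h1 := mvfderiv_fun_add (g.mdifferentiableAt_inner hZ hX) (g.mdifferentiableAt_inner hZ hX')
    have h2 := mvfderiv_fun_add (g.mdifferentiableAt_inner hX hY) (g.mdifferentiableAt_inner hX' hY)
    simp [Metric.koszul, h1, h2, mlieBracket_add_left hX hX']
    ring

theorem Metric.koszul_tensorial₂ {x : M} {Y X : Π x : M, TangentSpace 𝓘(ℝ, V) x}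
    (hY : MDiffAt (T% Y) x) (hX : MDiffAt (T% X) x) :
    TensorialAt 𝓘(ℝ, V) V (fun Z ↦ g.koszul Y X Z x) x where
  smul {f Z} hf hZ := by
    have : CompleteSpace V := FiniteDimensional.complete ℝ V
    have h1 := mvfderiv_fun_mul hf (g.mdifferentiableAt_inner hZ hX)
    have h2 := mvfderiv_fun_mul hf (g.mdifferentiableAt_inner hY hZ)
    simp [Metric.koszul, h1, h2, mlieBracket_smul_right hf hZ]
    rw [g.symm x (Z x) (X x), g.symm x (Z x) (Y x)]
    ring
  add {Z Z'} hZ hZ' := by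
    have : CompleteSpace V := FiniteDimensional.complete ℝ V
    have h1 := mvfderiv_fun_add (g.mdifferentiableAt_inner hZ hX) (g.mdifferentiableAt_inner hZ' hX)
    have h2 := mvfderiv_fun_add (g.mdifferentiableAt_inner hY hZ) (g.mdifferentiableAt_inner hY hZ')
    simp [Metric.koszul, h1, h2, mlieBracket_add_right hZ hZ']
    ring

theorem Metric.koszul_add {x : M} {Y Y' X Z : Π x : M, TangentSpace 𝓘(ℝ, V) x}
    (hY : MDiffAt (T% Y) x) (hY' : MDiffAt (T% Y') x)
    (hX : MDiffAt (T% X) x) (hZ : MDiffAt (T% Z) x) :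
    g.koszul (Y + Y') X Z x = g.koszul Y X Z x + g.koszul Y' X Z x := by
  have : CompleteSpace V := FiniteDimensional.complete ℝ V
  have h1 := mvfderiv_fun_add (g.mdifferentiableAt_inner hY hZ) (g.mdifferentiableAt_inner hY' hZ)
  have h2 := mvfderiv_fun_add (g.mdifferentiableAt_inner hX hY) (g.mdifferentiableAt_inner hX hY')
  simp [Metric.koszul, h1, h2, mlieBracket_add_left hY hY', mlieBracket_add_right hY hY']
  ring

theorem Metric.koszul_smul {x : M} {f : M → ℝ} {Y X Z : Π x : M, TangentSpace 𝓘(ℝ, V) x}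
    (hf : MDiffAt f x) (hY : MDiffAt (T% Y) x)
    (hX : MDiffAt (T% X) x) (hZ : MDiffAt (T% Z) x) :
    g.koszul (f • Y) X Z x = f x * g.koszul Y X Z x + d% f x (X x) * g.inner x (Y x) (Z x) := by
  have : CompleteSpace V := FiniteDimensional.complete ℝ V
  have h1 := mvfderiv_fun_mul hf (g.mdifferentiableAt_inner hY hZ)
  have h2 := mvfderiv_fun_mul hf (g.mdifferentiableAt_inner hX hY)
  simp [Metric.koszul, h1, h2, mlieBracket_smul_left hf hY, mlieBracket_smul_right hf hY]
  rw [g.symm x (X x) (Y x)]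
  ring

/-- The Koszul expression as a bilinear form in `(X x, Z x)`. -/
def Metric.koszulForm {Y : Π x : M, TangentSpace 𝓘(ℝ, V) x} {x : M} (hY : MDiffAt (T% Y) x) :
    TangentSpace 𝓘(ℝ, V) x →L[ℝ] TangentSpace 𝓘(ℝ, V) x →L[ℝ] ℝ :=
  TensorialAt.mkHom₂ (F := V) (F' := V) (I := 𝓘(ℝ, V)) (fun X Z ↦ g.koszul Y X Z x) x
    (fun _ hZ ↦ g.koszul_tensorial₁ hY hZ) (fun _ hX ↦ g.koszul_tensorial₂ hY hX)

theorem Metric.koszulForm_apply {Y X Z : Π x : M, TangentSpace 𝓘(ℝ, V) x} {x : M}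
    (hY : MDiffAt (T% Y) x) (hX : MDiffAt (T% X) x) (hZ : MDiffAt (T% Z) x) :
    g.koszulForm hY (X x) (Z x) = g.koszul Y X Z x :=
  TensorialAt.mkHom₂_apply (F := V) (F' := V) (I := 𝓘(ℝ, V)) _ _ hX hZ

/-- The musical isomorphism `v ↦ ⟨v, ·⟩`. -/
def Metric.flat (x : M) : TangentSpace 𝓘(ℝ, V) x ≃ₗ[ℝ] (TangentSpace 𝓘(ℝ, V) x →L[ℝ] ℝ) :=
  have : FiniteDimensional ℝ (TangentSpace 𝓘(ℝ, V) x) := inferInstanceAs (FiniteDimensional ℝ V)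
  LinearMap.linearEquivOfInjective (g.inner x).toLinearMap
    ((injective_iff_map_eq_zero (g.inner x).toLinearMap).2 fun v hv ↦
      g.nondegenerate x v fun w ↦ congrArg (fun φ ↦ φ w) hv)
    ((Subspace.dual_finrank_eq (K := ℝ) (V := V)).symm.trans
      (LinearMap.toContinuousLinearMap (𝕜 := ℝ) (E := V) (F' := ℝ)).finrank_eq)

theorem Metric.flat_apply (x : M) (v w : TangentSpace 𝓘(ℝ, V) x) :
    g.flat x v w = g.inner x v w := rfl

theorem Metric.inner_flat_symm (x : M) (φ : TangentSpace 𝓘(ℝ, V) x →L[ℝ] ℝ)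
    (w : TangentSpace 𝓘(ℝ, V) x) : g.inner x ((g.flat x).symm φ) w = φ w := by
  rw [← g.flat_apply, LinearEquiv.apply_symm_apply]

open Classical in
/-- The value at `x` of the Levi-Civita derivative `v ↦ ∇_v Y`, given by the Koszul formula
(and `0` by convention where the vector field `Y` is not differentiable). -/
def Metric.leviCivitaAt (Y : Π x : M, TangentSpace 𝓘(ℝ, V) x) (x : M) :
    TangentSpace 𝓘(ℝ, V) x →L[ℝ] TangentSpace 𝓘(ℝ, V) x :=
  have : FiniteDimensional ℝ (TangentSpace 𝓘(ℝ, V) x) := inferInstanceAs (FiniteDimensional ℝ V)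
  have : T2Space (TangentSpace 𝓘(ℝ, V) x) := inferInstanceAs (T2Space V)
  if hY : MDiffAt (T% Y) x then
    LinearMap.toContinuousLinearMap
      ((g.flat x).symm.toLinearMap ∘ₗ (g.koszulForm hY).toLinearMap)
  else 0

theorem Metric.inner_leviCivitaAt {Y X Z : Π x : M, TangentSpace 𝓘(ℝ, V) x} {x : M}
    (hY : MDiffAt (T% Y) x) (hX : MDiffAt (T% X) x) (hZ : MDiffAt (T% Z) x) :
    g.inner x (g.leviCivitaAt Y x (X x)) (Z x) = g.koszul Y X Z x := by
  rw [← g.koszulForm_apply hY hX hZ, Metric.leviCivitaAt, dif_pos hY]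
  exact g.inner_flat_symm x _ _

/-- The Levi-Civita connection of a pseudo-Riemannian metric; `g.leviCivita Y x v` is
`(∇_v Y)(x)`. -/
def Metric.leviCivita : CovariantDerivative 𝓘(ℝ, V) V (TangentSpace 𝓘(ℝ, V) : M → Type _) where
  toFun := g.leviCivitaAt
  isCovariantDerivativeOnUniv :=
    { add := by
        intro Y Y' x hY hY' _
        ext v
        refine g.ext_inner fun Z hZ ↦ ?_
        have hX : MDiffAt (T% (extend V v)) x := mdifferentiableAt_extend ..
        have h0 := g.inner_leviCivitaAt (mdifferentiableAt_add_section hY hY') hX hZ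
        have h1 := g.inner_leviCivitaAt hY hX hZ
        have h2 := g.inner_leviCivitaAt hY' hX hZ
        simp only [extend_apply_self] at h0 h1 h2
        simp [h0, h1, h2, g.koszul_add hY hY' hX hZ]
      leibniz := by
        intro Y f x hY hf _
        ext v
        refine g.ext_inner fun Z hZ ↦ ?_
        have hX : MDiffAt (T% (extend V v)) x := mdifferentiableAt_extend ..
        have h0 := g.inner_leviCivitaAt (hf.smul_section hY) hX hZ
        have h1 := g.inner_leviCivitaAt hY hX hZ
        simp only [extend_apply_self] at h0 h1
        have h2 := g.koszul_smul hf hY hX hZ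
        simp only [extend_apply_self] at h2
        simp [h0, h1, h2] }

/-- The Levi-Civita connection is torsion-free. -/
theorem Metric.leviCivita_torsion {X Y : Π x : M, TangentSpace 𝓘(ℝ, V) x} {x : M}
    (hX : MDiffAt (T% X) x) (hY : MDiffAt (T% Y) x) :
    g.leviCivita Y x (X x) - g.leviCivita X x (Y x) = mlieBracket 𝓘(ℝ, V) X Y x := by
  refine g.ext_inner fun Z hZ ↦ ?_
  have h1 := g.inner_leviCivitaAt hY hX hZ
  have h2 := g.inner_leviCivitaAt hX hY hZ
  change g.inner x (g.leviCivitaAt Y x (X x) - g.leviCivitaAt X x (Y x)) (Z x) = _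
  simp only [map_sub, sub_apply, h1, h2, Metric.koszul]
  rw [mlieBracket_swap_apply (V := Y) (W := X),
    (funext fun y ↦ g.symm y (X y) (Z y) :
      (fun y ↦ g.inner y (X y) (Z y)) = fun y ↦ g.inner y (Z y) (X y)),
    (funext fun y ↦ g.symm y (Y y) (Z y) :
      (fun y ↦ g.inner y (Y y) (Z y)) = fun y ↦ g.inner y (Z y) (Y y)),
    (funext fun y ↦ g.symm y (Y y) (X y) :
      (fun y ↦ g.inner y (Y y) (X y)) = fun y ↦ g.inner y (X y) (Y y))]
  simp
  ring

/-- The Levi-Civita connection is compatible with the metric. -/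
theorem Metric.leviCivita_metric {X Y Z : Π x : M, TangentSpace 𝓘(ℝ, V) x} {x : M}
    (hX : MDiffAt (T% X) x) (hY : MDiffAt (T% Y) x) (hZ : MDiffAt (T% Z) x) :
    d% (fun y ↦ g.inner y (Y y) (Z y)) x (X x) =
      g.inner x (g.leviCivita Y x (X x)) (Z x) + g.inner x (Y x) (g.leviCivita Z x (X x)) := by
  have h1 := g.inner_leviCivitaAt hY hX hZ
  have h2 := g.inner_leviCivitaAt hZ hX hY
  rw [g.symm x (Y x)]
  change _ = g.inner x (g.leviCivitaAt Y x (X x)) (Z x) + g.inner x (g.leviCivitaAt Z x (X x)) (Y x)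
  rw [h1, h2, Metric.koszul, Metric.koszul, mlieBracket_swap_apply (V := Z) (W := Y)]
  rw [(funext fun y ↦ g.symm y (Z y) (Y y) :
      (fun y ↦ g.inner y (Z y) (Y y)) = fun y ↦ g.inner y (Y y) (Z y)),
    (funext fun y ↦ g.symm y (Z y) (X y) :
      (fun y ↦ g.inner y (Z y) (X y)) = fun y ↦ g.inner y (X y) (Z y)),
    (funext fun y ↦ g.symm y (Y y) (X y) :
      (fun y ↦ g.inner y (Y y) (X y)) = fun y ↦ g.inner y (X y) (Y y))]
  simp
  ring

end LeviCivita

/-! ### Distributions -/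

/-- A field of tangent subspaces. -/
abbrev Distribution (V : Type*) [NormedAddCommGroup V] [NormedSpace ℝ V]
    (M : Type*) [TopologicalSpace M] [ChartedSpace V M] :=
  Π x : M, Submodule ℝ (TangentSpace 𝓘(ℝ, V) x)

section Geometry

variable [IsManifold 𝓘(ℝ, V) ∞ M]

/-- `E` is a smooth subbundle of the tangent bundle: it has a smooth frame near every point. -/
def Distribution.IsSmooth (E : Distribution V M) : Prop :=
  ∀ p : M, ∃ U : Set M, IsOpen U ∧ p ∈ U ∧
    ∃ (m : ℕ) (s : Fin m → Π x : M, TangentSpace 𝓘(ℝ, V) x),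
      (∀ a, CMDiff[U] ∞ (T% (s a))) ∧
      ∀ q ∈ U, LinearIndependent ℝ (fun a ↦ s a q) ∧
        Submodule.span ℝ (Set.range fun a ↦ s a q) = E q

/-- `X` is a smooth section of `E` over `U`. -/
structure Distribution.IsSectionOn (E : Distribution V M) (U : Set M)
    (X : Π x : M, TangentSpace 𝓘(ℝ, V) x) : Prop where
  smooth : CMDiff[U] ∞ (T% X)
  mem : ∀ x ∈ U, X x ∈ E x

variable (g : Metric V M)

/-- The orthogonal complement `E^⊥`. -/
def Metric.perp (E : Distribution V M) : Distribution V M := fun x ↦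
  { carrier := {w | ∀ v ∈ E x, g.inner x v w = 0}
    add_mem' := fun ha hb v hv ↦ by simp [ha v hv, hb v hv]
    zero_mem' := fun v _ ↦ by simp
    smul_mem' := fun c a ha v hv ↦ by simp [ha v hv] }

/-- The induced metric on `E` is non-degenerate at every point. -/
def Metric.IsNondegenerate (E : Distribution V M) : Prop :=
  ∀ x, ∀ v ∈ E x, (∀ w ∈ E x, g.inner x v w = 0) → v = 0

open Classical in
/-- The component `v^E` of `v` in the splitting `TM = E ⊕ E^⊥`, which exists when `E` is
non-degenerate (and `0` by convention when there is no such splitting). -/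
def Metric.tangentPart (E : Distribution V M) (x : M) :
    TangentSpace 𝓘(ℝ, V) x →ₗ[ℝ] TangentSpace 𝓘(ℝ, V) x :=
  if h : IsCompl (E x) (g.perp E x) then (E x).projection (g.perp E x) h else 0

/-- The component `v^{E^⊥} = v - v^E`. -/
def Metric.normalPart (E : Distribution V M) (x : M) :
    TangentSpace 𝓘(ℝ, V) x →ₗ[ℝ] TangentSpace 𝓘(ℝ, V) x :=
  LinearMap.id - g.tangentPart E x

variable [FiniteDimensional ℝ V]

/-- The generalized second fundamental form `s^E(X, Y) = (∇_X Y)^{E^⊥}`. -/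
def Metric.genSecondForm (E : Distribution V M) (X Y : Π x : M, TangentSpace 𝓘(ℝ, V) x) (x : M) :
    TangentSpace 𝓘(ℝ, V) x :=
  g.normalPart E x (g.leviCivita Y x (X x))

/-- The second fundamental form `h^E(X, Y) = (∇_X Y + ∇_Y X)^{E^⊥} / 2`. -/
def Metric.secondForm (E : Distribution V M) (X Y : Π x : M, TangentSpace 𝓘(ℝ, V) x) (x : M) :
    TangentSpace 𝓘(ℝ, V) x :=
  (1 / 2 : ℝ) • g.normalPart E x (g.leviCivita Y x (X x) + g.leviCivita X x (Y x))

/-- A section of `E` near `x` that extends the vector `v ∈ E x`. -/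
def Metric.sectionThrough (E : Distribution V M) {x : M} (v : E x) :
    Π y : M, TangentSpace 𝓘(ℝ, V) y :=
  fun y ↦ g.tangentPart E y (extend V (v : TangentSpace 𝓘(ℝ, V) x) y)

/-- The mean curvature normal `H_E = (1/m) tr h^E`, where `m` is the rank of `E`. The metric trace
`∑ g^{ab} h^E(e_a, e_b)` is taken in a basis `e` of `E x`, with `(g^{ab})` the inverse of the Gram
matrix of `e`; neither the basis nor the extension of its vectors to sections of `E` matters. -/
def Metric.meanCurvature (E : Distribution V M) (x : M) : TangentSpace 𝓘(ℝ, V) x :=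
  have : FiniteDimensional ℝ (TangentSpace 𝓘(ℝ, V) x) := inferInstanceAs (FiniteDimensional ℝ V)
  let m := Module.finrank ℝ (E x)
  let e : Module.Basis (Fin m) ℝ (E x) := Module.finBasis ℝ (E x)
  let gram : Matrix (Fin m) (Fin m) ℝ := Matrix.of fun a b ↦ g.inner x (e a) (e b)
  (1 / m : ℝ) • ∑ a, ∑ b,
    gram⁻¹ a b • g.secondForm E (g.sectionThrough E (e a)) (g.sectionThrough E (e b)) x

/-- `E` is geodesic: `s^E = 0`. -/
def Metric.IsGeodesic (E : Distribution V M) : Prop :=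
  ∀ (U : Set M) (X Y : Π x : M, TangentSpace 𝓘(ℝ, V) x), IsOpen U →
    E.IsSectionOn U X → E.IsSectionOn U Y → ∀ x ∈ U, g.genSecondForm E X Y x = 0

/-- `E` is umbilical: `s^E(X, Y) = ⟨X, Y⟩ H_E`. -/
def Metric.IsUmbilical (E : Distribution V M) : Prop :=
  ∀ (U : Set M) (X Y : Π x : M, TangentSpace 𝓘(ℝ, V) x), IsOpen U →
    E.IsSectionOn U X → E.IsSectionOn U Y →
    ∀ x ∈ U, g.genSecondForm E X Y x = g.inner x (X x) (Y x) • g.meanCurvature E x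

/-- `E` is spherical: it is umbilical and `∇^{E^⊥}_X H_E = (∇_X H_E)^{E^⊥} = 0` for all
sections `X` of `E`. The mean curvature normal of a smooth non-degenerate distribution is
automatically smooth; this is recorded so that the derivative is visibly meaningful. -/
structure Metric.IsSpherical (E : Distribution V M) : Prop where
  umbilical : g.IsUmbilical E
  smooth_meanCurvature : CMDiff ∞ (T% (g.meanCurvature E))
  parallel : ∀ (U : Set M) (X : Π x : M, TangentSpace 𝓘(ℝ, V) x), IsOpen U →
    E.IsSectionOn U X →
    ∀ x ∈ U, g.normalPart E x (g.leviCivita (g.meanCurvature E) x (X x)) = 0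

/-- `E` is Killing: it is spherical and its orthogonal complement is geodesic. -/
structure Metric.IsKilling (E : Distribution V M) : Prop where
  spherical : g.IsSpherical E
  perp_geodesic : g.IsGeodesic (g.perp E)

/-! ### Conformal Killing tensors -/

/-- A smooth symmetric tensor field of valence two, given as the field of `g`-self-adjoint
endomorphisms obtained from it by raising or lowering an index. -/
structure Metric.IsSymmetricTensor
    (T : Π x : M, TangentSpace 𝓘(ℝ, V) x →L[ℝ] TangentSpace 𝓘(ℝ, V) x) : Prop where
  smooth : ContMDiff 𝓘(ℝ, V) (𝓘(ℝ, V).prod 𝓘(ℝ, V →L[ℝ] V)) ∞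
    (fun x ↦ TotalSpace.mk' (V →L[ℝ] V) x (T x))
  symm : ∀ x v w, g.inner x (T x v) w = g.inner x v (T x w)

/-- `⟨(∇_X T) Y, Z⟩`, that is `(∇_X T)(Y, Z)` for the tensor with both indices lowered. -/
def Metric.covDerivTensor (T : Π x : M, TangentSpace 𝓘(ℝ, V) x →L[ℝ] TangentSpace 𝓘(ℝ, V) x)
    (X Y Z : Π x : M, TangentSpace 𝓘(ℝ, V) x) (x : M) : ℝ :=
  g.inner x (g.leviCivita (fun y ↦ T y (Y y)) x (X x) - T x (g.leviCivita Y x (X x))) (Z x)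

/-- `T` is a conformal Killing tensor: for some smooth vector field `t`, the conformal factor,
`∇_{(i} T_{jk)} = t_{(i} g_{jk)}`. -/
structure Metric.IsConformalKilling
    (T : Π x : M, TangentSpace 𝓘(ℝ, V) x →L[ℝ] TangentSpace 𝓘(ℝ, V) x) : Prop where
  symmetricTensor : g.IsSymmetricTensor T
  exists_conformalFactor : ∃ t : Π x : M, TangentSpace 𝓘(ℝ, V) x, CMDiff ∞ (T% t) ∧
    ∀ (U : Set M) (X Y Z : Π x : M, TangentSpace 𝓘(ℝ, V) x), IsOpen U →
      CMDiff[U] ∞ (T% X) → CMDiff[U] ∞ (T% Y) → CMDiff[U] ∞ (T% Z) → ∀ x ∈ U,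
        g.covDerivTensor T X Y Z x + g.covDerivTensor T Y Z X x + g.covDerivTensor T Z X Y x =
          g.inner x (t x) (X x) * g.inner x (Y x) (Z x)
            + g.inner x (t x) (Y x) * g.inner x (Z x) (X x)
            + g.inner x (t x) (Z x) * g.inner x (X x) (Y x)

/-! ### Nets -/

/-- `M` is locally a product adapted to `(E_i)`: near every point there is a diffeomorphism onto a
product `∏ S_i` of manifolds (which may be taken to be open sets of Euclidean spaces) that turns
the slices in the direction of the `i`-th factor into integral manifolds of `E_i`. -/
def IsLocallyDecomposable {k : ℕ} (E : Fin k → Distribution V M) : Prop :=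
  ∀ p : M, ∃ (m : Fin k → ℕ)
    (φ : OpenPartialHomeomorph M (Π i, EuclideanSpace ℝ (Fin (m i))))
    (S : Π i, Set (EuclideanSpace ℝ (Fin (m i)))),
    p ∈ φ.source ∧
    ContMDiffOn 𝓘(ℝ, V) 𝓘(ℝ, Π i, EuclideanSpace ℝ (Fin (m i))) ∞ φ φ.source ∧
    ContMDiffOn 𝓘(ℝ, Π i, EuclideanSpace ℝ (Fin (m i))) 𝓘(ℝ, V) ∞ φ.symm φ.target ∧
    (∀ i, IsOpen (S i)) ∧ φ.target = Set.univ.pi S ∧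
    ∀ q ∈ φ.source, ∀ (i : Fin k) (v : TangentSpace 𝓘(ℝ, V) q), v ∈ E i q ↔
      ∀ j, j ≠ i →
        (mfderiv 𝓘(ℝ, V) 𝓘(ℝ, Π i, EuclideanSpace ℝ (Fin (m i))) φ q v :
          Π i, EuclideanSpace ℝ (Fin (m i))) j = 0

/-- `(E_i)` is orthogonally integrable: it is a net of smooth non-degenerate distributions that
split `TM` as an orthogonal direct sum and are the tangent distributions of a local product
structure. In particular each `E_i` is integrable. -/
structure Metric.IsOrthogonallyIntegrable {k : ℕ} (E : Fin k → Distribution V M) : Prop where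
  smooth : ∀ i, (E i).IsSmooth
  nondegenerate : ∀ i, g.IsNondegenerate (E i)
  orthogonal : ∀ i j, i ≠ j → ∀ x, ∀ v ∈ E i x, ∀ w ∈ E j x, g.inner x v w = 0
  directSum : ∀ x, DirectSum.IsInternal fun i ↦ E i x
  decomposable : IsLocallyDecomposable E

/-- `(E_i)` is the net of eigenspaces of the conformal Killing tensor `T`, with eigenfunctions
`lam i`, and it is orthogonally integrable. As the `E_i` split `TM`, `T` is pointwise
diagonalizable and the `lam i x` are all its eigenvalues at `x`. -/
structure Metric.IsConformalKillingNet {k : ℕ}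
    (T : Π x : M, TangentSpace 𝓘(ℝ, V) x →L[ℝ] TangentSpace 𝓘(ℝ, V) x)
    (lam : Fin k → M → ℝ) (E : Fin k → Distribution V M) : Prop where
  conformalKilling : g.IsConformalKilling T
  distinct : ∀ i j, i ≠ j → ∀ x, lam i x ≠ lam j x
  mem_iff : ∀ i x v, v ∈ E i x ↔ T x v = lam i x • v
  ne_bot : ∀ i x, E i x ≠ ⊥
  orthogonallyIntegrable : g.IsOrthogonallyIntegrable E

end Geometry

end PseudoRiemannian

end

/-!
For sections `X, Y` of `Eᵢ` and `Z` of `Eⱼ`, `j ≠ i`, one has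
`(∇_X T)(Y, Z) = (λᵢ - λⱼ)⟨∇_X Y, Z⟩`. Integrability of `Eᵢ` makes `⟨∇_X Y, Z⟩` symmetric in
`X` and `Y`, so the conformal Killing equation in the arguments `X, Y, Z` expresses it through
`⟨X, Y⟩`, `Zλᵢ` and `⟨t, Z⟩`; since `⟨t, Z⟩ = Zλⱼ` by the same equation on `Eⱼ`, this says
`⟨∇_X Y, Z⟩ = ⟨X, Y⟩ Zf` with `f = -log √|λᵢ - λⱼ|`. Thus `Eᵢ` is umbilical, and `H` is the normal
field with `⟨H, Z⟩ = Zf` for every `j`.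

Let now `Eᵢ^⊥` be geodesic. Exchanging the roles of `i` and `j` gives `Xf = 0`. Moreover
`⟨∇_Z X, H⟩ = -⟨X, ∇_Z H⟩ = 0`, so `⟨∇_X H, Z⟩ = X⟨H, Z⟩ - ⟨H, [X, Z]⟩`. As `[X, Z]` lies in
`Eᵢ ⊕ Eⱼ`, where `⟨H, ·⟩ = df`, this equals `XZf - [X, Z]f = ZXf = 0`.
-/

namespace PseudoRiemannian

open Filter
open scoped Topology

section Calculus

variable {𝕜 : Type*} [NontriviallyNormedField 𝕜]
  {E : Type*} [NormedAddCommGroup E] [NormedSpace 𝕜 E]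
  {H : Type*} [TopologicalSpace H] {I : ModelWithCorners 𝕜 E H}
  {M : Type*} [TopologicalSpace M] [ChartedSpace H M] {x : M}

theorem mvfderiv_congr {F : Type*} [NormedAddCommGroup F] [NormedSpace 𝕜 F] {f f' : M → F}
    (h : f =ᶠ[𝓝 x] f') : d% f x = d% f' x := by
  ext v
  change (mfderiv I 𝓘(𝕜, F) f x v : F) = mfderiv I 𝓘(𝕜, F) f' x v
  rw [h.mfderiv_eq]
  rfl

theorem mvfderiv_clm_comp_apply {F F' : Type*} [NormedAddCommGroup F] [NormedSpace 𝕜 F]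
    [NormedAddCommGroup F'] [NormedSpace 𝕜 F'] (L : F →L[𝕜] F') {f : M → F} (hf : MDiffAt f x)
    (v : TangentSpace I x) : d% (fun y ↦ L (f y)) x v = L (mfderiv% f x v) := by
  have h := mfderiv_comp x L.mdifferentiableAt hf
  rw [L.mfderiv_eq] at h
  exact congrArg (fun A ↦ A v) h

theorem mvfderiv_comp_of_hasDerivAt {φ : 𝕜 → 𝕜} {φ' : 𝕜} {f : M → 𝕜}
    (hφ : HasDerivAt φ φ' (f x)) (hf : MDiffAt f x) :
    d% (fun y ↦ φ (f y)) x = φ' • d% f x := by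
  have h := (hφ.hasFDerivAt.hasMFDerivAt.comp x hf.hasMFDerivAt).mfderiv
  ext v
  exact (congrArg (fun A ↦ A v) h).trans (mul_comm (d% f x v) φ')

theorem contMDiffAt_mvfderiv_apply {m n : WithTop ℕ∞} [IsManifold I 1 M]
    {f : M → 𝕜} {X : Π x : M, TangentSpace I x} (hf : CMDiffAt n f x) (hX : CMDiffAt m (T% X) x)
    (hmn : m + 1 ≤ n) : CMDiffAt m (fun y ↦ d% f y (X y)) x := by
  have h := ContMDiffAt.clm_apply_of_inCoordinates (F₁ := E) (F₂ := 𝕜)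
      (E₁ := (TangentSpace I : M → Type _)) (E₂ := (TangentSpace 𝓘(𝕜, 𝕜) : 𝕜 → Type _))
      (b₁ := id) (b₂ := f) (hf.mfderiv_const hmn) hX (hf.of_le (le_self_add.trans hmn))
  exact (contMDiffAt_totalSpace.1 h).2.congr_of_eventuallyEq
    (.of_forall fun y ↦ by simp [mvfderiv]; rfl)

theorem eventually_mdifferentiableAt {E' H' N : Type*} [NormedAddCommGroup E'] [NormedSpace 𝕜 E']
    [TopologicalSpace H'] {J : ModelWithCorners 𝕜 E' H'} [TopologicalSpace N] [ChartedSpace H' N]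
    [IsManifold I 1 M] [IsManifold J 1 N] {f : M → N} (hf : CMDiffAt 1 f x) :
    ∀ᶠ y in 𝓝 x, MDiffAt f y :=
  ((contMDiffAt_iff_contMDiffAt_nhds (by simp)).1 hf).mono fun _ h ↦
    h.mdifferentiableAt one_ne_zero

variable [CompleteSpace E]

theorem mlieBracket_smul_right_eventuallyEq [IsManifold I 2 M] {f : M → 𝕜}
    {X Z : Π x : M, TangentSpace I x} (hf : CMDiffAt 1 f x) (hZ : CMDiffAt 1 (T% Z) x) :
    mlieBracket I X (f • Z) =ᶠ[𝓝 x] (fun y ↦ d% f y (X y)) • Z + f • mlieBracket I X Z := by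
  have : IsManifold I (1 + 1) M := by rwa [one_add_one_eq_two]
  filter_upwards [eventually_mdifferentiableAt hf, eventually_mdifferentiableAt hZ] with y h1 h2
  exact mlieBracket_smul_right h1 h2

variable [IsRCLikeNormedField 𝕜] [IsManifold I 3 M]

theorem contMDiffAt_mlieBracket {X Y : Π x : M, TangentSpace I x}
    (hX : CMDiffAt 2 (T% X) x) (hY : CMDiffAt 2 (T% Y) x) :
    CMDiffAt 1 (T% (mlieBracket I X Y)) x := by
  have : IsManifold I ((2 : ℕ∞) + 1 : WithTop ℕ∞) M := by norm_num; infer_instance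
  have : IsManifold I (minSmoothness 𝕜 3) M := by
    rwa [minSmoothness_of_isRCLikeNormedField]
  have : IsManifold I (minSmoothness 𝕜 2) M := by
    rw [minSmoothness_of_isRCLikeNormedField]; infer_instance
  refine ContMDiffAt.mlieBracket_vectorField (m := 1) (n := 2) hX hY ?_
  norm_num

theorem mlieBracket_mlieBracket_smul_right {f : M → 𝕜} {X Y Z : Π x : M, TangentSpace I x}
    (hf : CMDiffAt 2 f x) (hY : CMDiffAt 2 (T% Y) x)
    (hZ : CMDiffAt 2 (T% Z) x) :
    mlieBracket I X (mlieBracket I Y (f • Z)) x =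
      d% (fun y ↦ d% f y (Y y)) x (X x) • Z x + d% f x (Y x) • mlieBracket I X Z x
        + (d% f x (X x) • mlieBracket I Y Z x + f x • mlieBracket I X (mlieBracket I Y Z) x) := by
  have hf1 : MDiffAt f x := hf.mdifferentiableAt two_ne_zero
  have hZ1 : MDiffAt (T% Z) x := hZ.mdifferentiableAt two_ne_zero
  have hYf : MDiffAt (fun y ↦ d% f y (Y y)) x :=
    (contMDiffAt_mvfderiv_apply (m := 1) hf (hY.of_le one_le_two)
      (by norm_num)).mdifferentiableAt one_ne_zero
  have hYZ : MDiffAt (T% (mlieBracket I Y Z)) x :=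
    (contMDiffAt_mlieBracket hY hZ).mdifferentiableAt one_ne_zero
  have hev : mlieBracket I Y (f • Z) =ᶠ[𝓝 x] _ :=
    mlieBracket_smul_right_eventuallyEq (hf.of_le one_le_two) (hZ.of_le one_le_two)
  rw [EventuallyEq.rfl.mlieBracket_vectorField_eq hev,
    mlieBracket_add_right (hYf.smul_section hZ1) (hf1.smul_section hYZ),
    mlieBracket_smul_right hYf hZ1, mlieBracket_smul_right hf1 hYZ]

theorem mvfderiv_mlieBracket_apply {f : M → 𝕜} {X Y : Π x : M, TangentSpace I x}
    (hf : CMDiffAt 2 f x) (hX : CMDiffAt 2 (T% X) x) (hY : CMDiffAt 2 (T% Y) x) :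
    d% f x (mlieBracket I X Y x) =
      d% (fun y ↦ d% f y (Y y)) x (X x) - d% (fun y ↦ d% f y (X y)) x (Y x) := by
  have : IsManifold I (2 + 1) M := by rwa [two_add_one_eq_three]
  have : IsManifold I (minSmoothness 𝕜 3) M := by
    rwa [minSmoothness_of_isRCLikeNormedField]
  rcases subsingleton_or_nontrivial (TangentSpace I x) with _ | _
  · simp [Subsingleton.elim _ (0 : TangentSpace I x)]
  obtain ⟨z, hz⟩ := exists_ne (0 : TangentSpace I x)
  set Z : Π x : M, TangentSpace I x := extend E z with hZ_def
  have hZ : CMDiffAt 2 (T% Z) x := contMDiffAt_extend ..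
  have hjacobi (W : Π x : M, TangentSpace I x) (hW : CMDiffAt 2 (T% W) x) :=
    leibniz_identity_mlieBracket_apply (U := X) (V := Y) (W := W) (x := x)
      (by rwa [minSmoothness_of_isRCLikeNormedField])
      (by rwa [minSmoothness_of_isRCLikeNormedField])
      (by rwa [minSmoothness_of_isRCLikeNormedField])
  have hfZ := hjacobi (f • Z) (hf.smul_section hZ)
  rw [mlieBracket_mlieBracket_smul_right hf hY hZ, mlieBracket_mlieBracket_smul_right hf hX hZ,
    mlieBracket_smul_right (hf.mdifferentiableAt two_ne_zero) (hZ.mdifferentiableAt two_ne_zero),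
    hjacobi Z hZ] at hfZ
  have hcoeff : (d% f x (mlieBracket I X Y x) -
      (d% (fun y ↦ d% f y (Y y)) x (X x) - d% (fun y ↦ d% f y (X y)) x (Y x))) • Z x = 0 := by
    linear_combination (norm := module) -hfZ
  rw [hZ_def, extend_apply_self] at hcoeff
  exact sub_eq_zero.1 ((smul_eq_zero.1 hcoeff).resolve_right hz)

end Calculus

section MatrixCalculus

variable {𝕜 : Type*} [NontriviallyNormedField 𝕜]
  {E : Type*} [NormedAddCommGroup E] [NormedSpace 𝕜 E]
  {H : Type*} [TopologicalSpace H] {I : ModelWithCorners 𝕜 E H}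
  {M : Type*} [TopologicalSpace M] [ChartedSpace H M] {x : M}
  {n : WithTop ℕ∞} {ι : Type*} [Fintype ι] [DecidableEq ι] {A : M → Matrix ι ι 𝕜}

theorem contMDiffAt_matrix_det (hA : ∀ a b, CMDiffAt n (fun y ↦ A y a b) x) :
    CMDiffAt n (fun y ↦ (A y).det) x := by
  simp only [Matrix.det_apply']
  exact contMDiffAt_finsetSum fun σ _ ↦ contMDiffAt_const.mul <|
    contMDiffAt_finsetProd fun a _ ↦ hA (σ a) a

theorem contMDiffAt_matrix_inv (hA : ∀ a b, CMDiffAt n (fun y ↦ A y a b) x)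
    (hdet : (A x).det ≠ 0) (a b : ι) : CMDiffAt n (fun y ↦ (A y)⁻¹ a b) x := by
  simp only [Matrix.inv_def, Ring.inverse_eq_inv', Matrix.smul_apply, smul_eq_mul,
    Matrix.adjugate_apply]
  refine ((contMDiffAt_matrix_det hA).inv₀ hdet).mul (contMDiffAt_matrix_det fun c d ↦ ?_)
  obtain rfl | hcb := eq_or_ne c b
  · simpa only [Matrix.updateRow_self] using contMDiffAt_const
  · simpa only [Matrix.updateRow_ne hcb] using hA c d

end MatrixCalculus

section LinearAlgebra

variable {K W ι : Type*} [Field K] [AddCommGroup W] [Module K W]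

theorem repr_eq_toMatrix_inv_mulVec [Fintype ι] [DecidableEq ι] {B : LinearMap.BilinForm K W}
    (hB : B.Nondegenerate) (b : Module.Basis ι K W) (w : W) :
    ⇑(b.repr w) = (LinearMap.BilinForm.toMatrix b B)⁻¹.mulVec fun a ↦ B (b a) w := by
  have hdet := (LinearMap.BilinForm.nondegenerate_iff_det_ne_zero b).1 hB
  have hmul : (LinearMap.BilinForm.toMatrix b B).mulVec (b.repr w) = fun a ↦ B (b a) w := by
    funext a
    simp [LinearMap.BilinForm.apply_eq_dotProduct_toMatrix_mulVec b B (b a) w,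
      Finsupp.single_eq_pi_single]
  rw [← hmul, Matrix.mulVec_mulVec, Matrix.nonsing_inv_mul _ hdet.isUnit, Matrix.one_mulVec]

theorem sum_inv_mul_of_isSymm [Fintype ι] [DecidableEq ι] {G : Matrix ι ι K} (hG : G.IsSymm)
    (hdet : G.det ≠ 0) :
    ∑ a, ∑ b, G⁻¹ a b * G a b = Fintype.card ι := by
  have h := Matrix.sum_hadamard_eq G⁻¹ G
  rwa [hG.eq, Matrix.nonsing_inv_mul G hdet.isUnit, Matrix.trace_one] at h

theorem mem_sup_of_apply_eq_zero [Finite ι] {F : ι → Type*} [∀ i, AddCommGroup (F i)]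
    [∀ i, Module K (F i)] {D : W →ₗ[K] Π i, F i} {E : ι → Submodule K W} (hE : ⨆ i, E i = ⊤)
    (hmem : ∀ i v, v ∈ E i ↔ ∀ j, j ≠ i → D v j = 0) {i j : ι} {v : W}
    (hv : ∀ l, l ≠ i → l ≠ j → D v l = 0) : v ∈ E i ⊔ E j := by
  classical
  have := Fintype.ofFinite ι
  obtain ⟨w, rfl⟩ : ∃ w : Π l, E l, ∑ l, (w l : W) = v := by
    obtain ⟨c, hc, hsum⟩ := (Submodule.mem_iSup_iff_exists_finsupp E v).1 (hE ▸ trivial)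
    exact ⟨fun l ↦ ⟨c l, hc l⟩, by rw [← hsum, Finsupp.sum_fintype _ _ fun _ ↦ rfl]⟩
  have hD (l : ι) : D (∑ l, (w l : W)) l = D (w l) l := by
    rw [map_sum, Finset.sum_apply]
    exact Finset.sum_eq_single l (fun m _ hm ↦ (hmem m _).1 (w m).2 l hm.symm) (by simp)
  refine Submodule.sum_mem _ fun l _ ↦ ?_
  by_cases hl : l = i ∨ l = j
  · obtain rfl | rfl := hl
    · exact Submodule.mem_sup_left (w l).2
    · exact Submodule.mem_sup_right (w l).2
  · rw [not_or] at hl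
    refine Submodule.mem_sup_left ((hmem i _).2 fun m _ ↦ ?_)
    obtain rfl | hml := eq_or_ne m l
    · rw [← hD, hv m hl.1 hl.2]
    · exact (hmem l _).1 (w l).2 m hml

end LinearAlgebra

section Splitting

variable {V : Type*} [NormedAddCommGroup V] [NormedSpace ℝ V]
  {M : Type*} [TopologicalSpace M] [ChartedSpace V M] [IsManifold 𝓘(ℝ, V) ∞ M]
  {g : Metric V M} {E : Distribution V M} {x : M} {v w : TangentSpace 𝓘(ℝ, V) x}

theorem Metric.tangentPart_mem (v : TangentSpace 𝓘(ℝ, V) x) : g.tangentPart E x v ∈ E x := by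
  unfold Metric.tangentPart
  split_ifs with h
  · exact Submodule.projection_apply_mem h v
  · exact Submodule.zero_mem _

theorem Metric.tangentPart_add_normalPart (v : TangentSpace 𝓘(ℝ, V) x) :
    g.tangentPart E x v + g.normalPart E x v = v :=
  add_sub_cancel _ _

theorem Metric.mem_of_normalPart_eq_zero (h : g.normalPart E x v = 0) : v ∈ E x := by
  rw [← g.tangentPart_add_normalPart (E := E) v, h, add_zero]
  exact g.tangentPart_mem v

theorem Metric.inner_normalPart_left (hw : w ∈ g.perp E x) :
    g.inner x (g.normalPart E x v) w = g.inner x v w := by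
  conv_rhs => rw [← g.tangentPart_add_normalPart (E := E) v, map_add, add_apply,
    hw _ (g.tangentPart_mem v), zero_add]

theorem Metric.IsNondegenerate.nondegenerate_restrict (hE : g.IsNondegenerate E) (x : M) :
    ((g.inner x).toBilinForm.restrict (E x)).Nondegenerate :=
  ⟨fun v h ↦ Subtype.ext (hE x v v.2 fun w hw ↦ h ⟨w, hw⟩),
    fun v h ↦ Subtype.ext (hE x v v.2 fun w hw ↦ (g.symm x v w).trans (h ⟨w, hw⟩))⟩

variable [FiniteDimensional ℝ V]

theorem Metric.IsNondegenerate.isCompl_perp (hE : g.IsNondegenerate E) (x : M) :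
    IsCompl (E x) (g.perp E x) := by
  have : FiniteDimensional ℝ (TangentSpace 𝓘(ℝ, V) x) := inferInstanceAs (FiniteDimensional ℝ V)
  exact LinearMap.BilinForm.isCompl_orthogonal_of_restrict_nondegenerate
    (fun v w h ↦ (g.symm x w v).trans h) (hE.nondegenerate_restrict x)

theorem Metric.IsNondegenerate.normalPart_mem_perp (hE : g.IsNondegenerate E)
    (v : TangentSpace 𝓘(ℝ, V) x) : g.normalPart E x v ∈ g.perp E x := by
  have h := hE.isCompl_perp x
  rw [Metric.normalPart, Metric.tangentPart, dif_pos h, LinearMap.sub_apply, LinearMap.id_apply,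
    ← Submodule.projection_eq_self_sub_projection h]
  exact Submodule.projection_apply_mem h.symm v

theorem Metric.IsNondegenerate.inner_tangentPart_left (hE : g.IsNondegenerate E) (hw : w ∈ E x) :
    g.inner x (g.tangentPart E x v) w = g.inner x v w := by
  conv_rhs => rw [← g.tangentPart_add_normalPart (E := E) v, map_add, add_apply,
    g.symm x (g.normalPart E x v), hE.normalPart_mem_perp v w hw, add_zero]

theorem Metric.IsNondegenerate.tangentPart_of_mem (hE : g.IsNondegenerate E) (hv : v ∈ E x) :
    g.tangentPart E x v = v := by
  rw [Metric.tangentPart, dif_pos (hE.isCompl_perp x), Submodule.projection_apply_of_mem_left _ hv]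

end Splitting

section Gram

variable {V : Type*} [NormedAddCommGroup V] [NormedSpace ℝ V]
  {M : Type*} [TopologicalSpace M] [ChartedSpace V M] [IsManifold 𝓘(ℝ, V) ∞ M]
  {ι : Type*} {g : Metric V M} {E : Distribution V M} {x : M}

/-- The Gram matrix of a family of tangent vectors. -/
noncomputable def Metric.gram (g : Metric V M) (s : ι → TangentSpace 𝓘(ℝ, V) x) : Matrix ι ι ℝ :=
  Matrix.of fun a b ↦ g.inner x (s a) (s b)

theorem Metric.gram_isSymm (s : ι → TangentSpace 𝓘(ℝ, V) x) : (g.gram s).IsSymm :=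
  Matrix.IsSymm.ext fun a b ↦ g.symm x (s b) (s a)

variable [Fintype ι] [DecidableEq ι]

theorem Metric.toMatrix_restrict (b : Module.Basis ι ℝ (E x)) :
    LinearMap.BilinForm.toMatrix b ((g.inner x).toBilinForm.restrict (E x)) =
      g.gram fun a ↦ (b a : TangentSpace 𝓘(ℝ, V) x) :=
  Matrix.ext fun a c ↦ LinearMap.BilinForm.toMatrix_apply b _ a c

theorem Metric.IsNondegenerate.det_gram_ne_zero (hE : g.IsNondegenerate E)
    (b : Module.Basis ι ℝ (E x)) : (g.gram fun a ↦ (b a : TangentSpace 𝓘(ℝ, V) x)).det ≠ 0 := by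
  rw [← g.toMatrix_restrict]
  exact (LinearMap.BilinForm.nondegenerate_iff_det_ne_zero b).1 (hE.nondegenerate_restrict x)

theorem Metric.IsNondegenerate.eq_sum_gram_inv_smul (hE : g.IsNondegenerate E)
    (b : Module.Basis ι ℝ (E x)) {w : TangentSpace 𝓘(ℝ, V) x} (hw : w ∈ E x) :
    w = ∑ a, (∑ c, (g.gram fun a ↦ (b a : TangentSpace 𝓘(ℝ, V) x))⁻¹ a c * g.inner x (b c) w) •
      (b a : TangentSpace 𝓘(ℝ, V) x) := by
  have h := congrArg ((E x).subtype) (b.sum_repr ⟨w, hw⟩)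
  rw [repr_eq_toMatrix_inv_mulVec (hE.nondegenerate_restrict x), g.toMatrix_restrict, map_sum] at h
  exact h.symm

end Gram

section Smoothness

variable {V : Type*} [NormedAddCommGroup V] [NormedSpace ℝ V]
  {M : Type*} [TopologicalSpace M] [ChartedSpace V M] [IsManifold 𝓘(ℝ, V) ∞ M]
  {g : Metric V M} {E : Distribution V M} {x : M} {X Y W : Π x : M, TangentSpace 𝓘(ℝ, V) x}

theorem Metric.contMDiffAt_inner (hX : CMDiffAt ∞ (T% X) x) (hY : CMDiffAt ∞ (T% Y) x) :
    CMDiffAt ∞ (fun y ↦ g.inner y (X y) (Y y)) x := by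
  have h : ContMDiffAt 𝓘(ℝ, V) (𝓘(ℝ, V).prod 𝓘(ℝ)) ∞
      (fun m ↦ TotalSpace.mk' ℝ (E := Trivial M ℝ) m (g.inner m (X m) (Y m))) x :=
    ContMDiffAt.clm_bundle_apply₂ (F₁ := V) (F₂ := V) (g.contMDiff x) hX hY
  exact (contMDiffAt_totalSpace.1 h).2

theorem Metric.IsNondegenerate.contMDiffAt_of_inner_frame {ι : Type*} [Finite ι]
    (hE : g.IsNondegenerate E) {s : ι → Π x : M, TangentSpace 𝓘(ℝ, V) x}
    (hs : ∀ a, CMDiffAt ∞ (T% (s a)) x)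
    (hframe : ∀ᶠ y in 𝓝 x, LinearIndependent ℝ (fun a ↦ s a y) ∧
      Submodule.span ℝ (Set.range fun a ↦ s a y) = E y)
    (hmem : ∀ᶠ y in 𝓝 x, W y ∈ E y)
    (hW : ∀ a, CMDiffAt ∞ (fun y ↦ g.inner y (s a y) (W y)) x) : CMDiffAt ∞ (T% W) x := by
  classical
  have := Fintype.ofFinite ι
  have hbasis : ∀ᶠ y in 𝓝 x, ∃ b : Module.Basis ι ℝ (E y), ∀ a, s a y = b a :=
    hframe.mono fun y ⟨hli, hspan⟩ ↦
      ⟨(Module.Basis.span hli).map (LinearEquiv.ofEq _ _ hspan), fun a ↦ by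
        simp [Module.Basis.span_apply]⟩
  have hinv (a c : ι) : CMDiffAt ∞ (fun y ↦ (g.gram fun a ↦ s a y)⁻¹ a c) x := by
    obtain ⟨b, hb⟩ := hbasis.self_of_nhds
    refine contMDiffAt_matrix_inv (A := fun y ↦ g.gram fun a ↦ s a y)
      (fun a c ↦ g.contMDiffAt_inner (hs a) (hs c)) ?_ a c
    simpa only [hb] using hE.det_gram_ne_zero b
  have hcoeff (a : ι) : CMDiffAt ∞
      (fun y ↦ ∑ c, (g.gram fun a ↦ s a y)⁻¹ a c * g.inner y (s c y) (W y)) x :=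
    contMDiffAt_finsetSum fun c _ ↦ (hinv a c).mul (hW c)
  refine (ContMDiffAt.sum_section fun a (_ : a ∈ Finset.univ) ↦
    (hcoeff a).smul_section (hs a)).congr_of_eventuallyEq ?_
  filter_upwards [hbasis, hmem] with y ⟨b, hb⟩ hy
  refine congrArg (TotalSpace.mk y) ((hE.eq_sum_gram_inv_smul b hy).trans ?_)
  simp only [Pi.smul_apply', hb]

theorem Metric.contMDiffAt_of_inner [FiniteDimensional ℝ V]
    (hW : ∀ Z : Π x : M, TangentSpace 𝓘(ℝ, V) x, CMDiffAt ∞ (T% Z) x →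
      CMDiffAt ∞ (fun y ↦ g.inner y (Z y) (W y)) x) : CMDiffAt ∞ (T% W) x := by
  let e := trivializationAt V (TangentSpace 𝓘(ℝ, V) : M → Type _) x
  have hx : x ∈ e.baseSet := mem_baseSet_trivializationAt' x
  have hf := e.isLocalFrameOn_localFrame_baseSet 𝓘(ℝ, V) ∞ (Module.finBasis ℝ V)
  have hs (a) := hf.contMDiffAt e.open_baseSet hx a
  have htop : g.IsNondegenerate fun _ ↦ ⊤ := fun y v _ h ↦ g.nondegenerate y v fun w ↦ h w trivial
  refine htop.contMDiffAt_of_inner_frame hs ?_ (.of_forall fun _ ↦ trivial) fun a ↦ hW _ (hs a)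
  filter_upwards [e.open_baseSet.mem_nhds hx] with y hy
  exact ⟨hf.linearIndependent hy, top_le_iff.1 (hf.generating hy)⟩

theorem Metric.IsNondegenerate.contMDiffAt_tangentPart [FiniteDimensional ℝ V]
    (hE : g.IsNondegenerate E) (hs : E.IsSmooth) (hX : CMDiffAt ∞ (T% X) x) :
    CMDiffAt ∞ (T% fun y ↦ g.tangentPart E y (X y)) x := by
  obtain ⟨U, hU, hxU, m, s, hsm, hframe⟩ := hs x
  have hs (a : Fin m) := (hsm a).contMDiffAt (hU.mem_nhds hxU)
  refine hE.contMDiffAt_of_inner_frame hs (eventually_of_mem (hU.mem_nhds hxU) hframe)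
    (.of_forall fun y ↦ g.tangentPart_mem _) fun a ↦ ?_
  refine (g.contMDiffAt_inner (hs a) hX).congr_of_eventuallyEq ?_
  filter_upwards [hU.mem_nhds hxU] with y hy
  rw [g.symm, g.symm y (s a y)]
  exact hE.inner_tangentPart_left ((hframe y hy).2 ▸ Submodule.subset_span ⟨a, rfl⟩)

end Smoothness

section Sections

variable {V : Type*} [NormedAddCommGroup V] [NormedSpace ℝ V]
  {M : Type*} [TopologicalSpace M] [ChartedSpace V M] [IsManifold 𝓘(ℝ, V) ∞ M]
  {g : Metric V M} {E E' : Distribution V M} {x : M} {U : Set M}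
  {X Y : Π x : M, TangentSpace 𝓘(ℝ, V) x}

/-- Near `x`, the vector field `X` is a smooth section of `E`. Smoothness is required at all points
near `x`, since being `C^∞` at `x` alone does not make `X` smooth on a neighbourhood of `x`. -/
def Distribution.IsSectionAt (E : Distribution V M) (x : M)
    (X : Π x : M, TangentSpace 𝓘(ℝ, V) x) : Prop :=
  ∀ᶠ y in 𝓝 x, CMDiffAt ∞ (T% X) y ∧ X y ∈ E y

namespace Distribution

theorem IsSectionOn.isSectionAt (hX : E.IsSectionOn U X) (hU : IsOpen U) (hx : x ∈ U) :
    E.IsSectionAt x X :=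
  eventually_of_mem (hU.mem_nhds hx) fun y hy ↦
    ⟨hX.smooth.contMDiffAt (hU.mem_nhds hy), hX.mem y hy⟩

theorem IsSectionAt.contMDiffAt (hX : E.IsSectionAt x X) : CMDiffAt ∞ (T% X) x :=
  hX.self_of_nhds.1

theorem IsSectionAt.mdifferentiableAt (hX : E.IsSectionAt x X) : MDiffAt (T% X) x :=
  hX.contMDiffAt.mdifferentiableAt (by simp)

theorem IsSectionAt.mem (hX : E.IsSectionAt x X) : X x ∈ E x :=
  hX.self_of_nhds.2

theorem IsSectionAt.eventually_mem (hX : E.IsSectionAt x X) : ∀ᶠ y in 𝓝 x, X y ∈ E y :=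
  hX.mono fun _ h ↦ h.2

theorem IsSectionAt.mono (hX : E.IsSectionAt x X) (h : E ≤ E') : E'.IsSectionAt x X :=
  Eventually.mono hX fun y hy ↦ ⟨hy.1, h y hy.2⟩

theorem IsSectionAt.exists_isSectionOn (hX : E.IsSectionAt x X) :
    ∃ U, IsOpen U ∧ x ∈ U ∧ E.IsSectionOn U X := by
  obtain ⟨U, hXU, hU, hx⟩ := eventually_nhds_iff.1 hX
  exact ⟨U, hU, hx, fun y hy ↦ (hXU y hy).1.contMDiffWithinAt, fun y hy ↦ (hXU y hy).2⟩

theorem IsSectionOn.mono {U' : Set M} (hX : E.IsSectionOn U X) (h : U' ⊆ U) :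
    E.IsSectionOn U' X :=
  ⟨hX.smooth.mono h, fun x hx ↦ hX.mem x (h hx)⟩

end Distribution

variable [FiniteDimensional ℝ V]

theorem Metric.IsNondegenerate.isSectionAt_tangentPart (hE : g.IsNondegenerate E) (hs : E.IsSmooth)
    (hX : ∀ᶠ y in 𝓝 x, CMDiffAt ∞ (T% X) y) :
    E.IsSectionAt x fun y ↦ g.tangentPart E y (X y) :=
  hX.mono fun _ hy ↦ ⟨hE.contMDiffAt_tangentPart hs hy, g.tangentPart_mem _⟩

theorem Metric.IsNondegenerate.isSectionAt_sectionThrough (hE : g.IsNondegenerate E)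
    (hs : E.IsSmooth) (v : E x) : E.IsSectionAt x (g.sectionThrough E v) := by
  refine hE.isSectionAt_tangentPart hs ?_
  obtain ⟨s, hsx, hv⟩ := exists_contMDiffOn_extend 𝓘(ℝ, V) V (k := ∞) (v : TangentSpace 𝓘(ℝ, V) x)
  filter_upwards [eventually_mem_nhds_iff.2 hsx] with y hy
  exact hv.contMDiffAt hy

theorem Metric.IsNondegenerate.sectionThrough_self (hE : g.IsNondegenerate E) (v : E x) :
    g.sectionThrough E v x = v := by
  simp only [Metric.sectionThrough, extend_apply_self]
  exact hE.tangentPart_of_mem v.2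

theorem Metric.IsNondegenerate.exists_isSectionAt (hE : g.IsNondegenerate E) (hs : E.IsSmooth)
    {v : TangentSpace 𝓘(ℝ, V) x} (hv : v ∈ E x) : ∃ X, E.IsSectionAt x X ∧ X x = v :=
  ⟨_, hE.isSectionAt_sectionThrough hs ⟨v, hv⟩, hE.sectionThrough_self ⟨v, hv⟩⟩

theorem Metric.IsGeodesic.genSecondForm_eq_zero (h : g.IsGeodesic E) (hX : E.IsSectionAt x X)
    (hY : E.IsSectionAt x Y) : g.genSecondForm E X Y x = 0 := by
  obtain ⟨U, hU, hxU, hXU⟩ := hX.exists_isSectionOn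
  obtain ⟨U', hU', hxU', hYU'⟩ := hY.exists_isSectionOn
  exact h (U ∩ U') X Y (hU.inter hU') (hXU.mono Set.inter_subset_left)
    (hYU'.mono Set.inter_subset_right) x ⟨hxU, hxU'⟩

end Sections

section MeanCurvature

variable {V : Type*} [NormedAddCommGroup V] [NormedSpace ℝ V]
  {M : Type*} [TopologicalSpace M] [ChartedSpace V M] [IsManifold 𝓘(ℝ, V) ∞ M]
  {g : Metric V M} {E : Distribution V M} {x : M} [FiniteDimensional ℝ V]

theorem Metric.IsNondegenerate.meanCurvature_eq (hE : g.IsNondegenerate E) (hs : E.IsSmooth)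
    (hbot : E x ≠ ⊥) {N : TangentSpace 𝓘(ℝ, V) x}
    (hN : ∀ X Y, E.IsSectionAt x X → E.IsSectionAt x Y →
      g.genSecondForm E X Y x = g.inner x (X x) (Y x) • N) :
    g.meanCurvature E x = N := by
  have : FiniteDimensional ℝ (TangentSpace 𝓘(ℝ, V) x) := inferInstanceAs (FiniteDimensional ℝ V)
  have : Nontrivial (E x) := (Submodule.nontrivial_iff_ne_bot).2 hbot
  have hsecond (v w : E x) : g.secondForm E (g.sectionThrough E v) (g.sectionThrough E w) x =
      g.inner x v w • N := by
    have hs (v w : E x) := hN _ _ (hE.isSectionAt_sectionThrough hs v)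
      (hE.isSectionAt_sectionThrough hs w)
    simp only [Metric.genSecondForm, hE.sectionThrough_self] at hs
    rw [Metric.secondForm, map_add, hE.sectionThrough_self, hE.sectionThrough_self, hs, hs,
      g.symm x w v, ← two_smul ℝ, smul_smul]
    norm_num
  let e := Module.finBasis ℝ (E x)
  have hm : (Module.finrank ℝ (E x) : ℝ) ≠ 0 := Nat.cast_ne_zero.2 Module.finrank_pos.ne'
  have htrace := sum_inv_mul_of_isSymm (g.gram_isSymm _) (hE.det_gram_ne_zero e)
  rw [Fintype.card_fin] at htrace
  have hsum : ∑ a, ∑ c, (g.gram fun a ↦ (e a : TangentSpace 𝓘(ℝ, V) x))⁻¹ a c •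
      g.secondForm E (g.sectionThrough E (e a)) (g.sectionThrough E (e c)) x =
      (Module.finrank ℝ (E x) : ℝ) • N := by
    simp only [hsecond, smul_smul, ← Finset.sum_smul]
    exact congrArg (· • N) htrace
  exact (congrArg (((1 : ℝ) / Module.finrank ℝ (E x)) • ·) hsum).trans (by
    rw [smul_smul, one_div_mul_cancel hm, one_smul])

end MeanCurvature

section Gradient

variable {V : Type*} [NormedAddCommGroup V] [NormedSpace ℝ V] [FiniteDimensional ℝ V]
  {M : Type*} [TopologicalSpace M] [ChartedSpace V M] [IsManifold 𝓘(ℝ, V) ∞ M]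
  {g : Metric V M} {E : Distribution V M} {x : M} {X Y Z : Π x : M, TangentSpace 𝓘(ℝ, V) x}

/-- The gradient of a function, the vector field dual to its differential. -/
noncomputable def Metric.gradient (g : Metric V M) (f : M → ℝ) (x : M) :
    TangentSpace 𝓘(ℝ, V) x :=
  (g.flat x).symm (d% f x)

theorem Metric.inner_gradient (f : M → ℝ) (v : TangentSpace 𝓘(ℝ, V) x) :
    g.inner x (g.gradient f x) v = d% f x v :=
  g.inner_flat_symm x _ v

theorem Metric.contMDiffAt_gradient {f : M → ℝ} (hf : CMDiffAt ∞ f x) :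
    CMDiffAt ∞ (T% (g.gradient f)) x := by
  refine g.contMDiffAt_of_inner fun Z hZ ↦ ?_
  simp only [g.symm _ (Z _), g.inner_gradient]
  exact contMDiffAt_mvfderiv_apply hf hZ le_rfl

theorem Metric.inner_leviCivita_of_inner_eq_zero (hX : MDiffAt (T% X) x) (hY : MDiffAt (T% Y) x)
    (hZ : MDiffAt (T% Z) x) (h : ∀ᶠ y in 𝓝 x, g.inner y (Y y) (Z y) = 0) :
    g.inner x (g.leviCivita Y x (X x)) (Z x) = -g.inner x (Y x) (g.leviCivita Z x (X x)) := by
  have hderiv := g.leviCivita_metric hX hY hZ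
  rw [mvfderiv_congr h, mvfderiv_const, zero_apply] at hderiv
  exact eq_neg_of_add_eq_zero_left hderiv.symm

theorem Metric.IsGeodesic.leviCivita_mem (hE : g.IsGeodesic E) (hX : E.IsSectionAt x X)
    (hY : E.IsSectionAt x Y) : g.leviCivita Y x (X x) ∈ E x :=
  g.mem_of_normalPart_eq_zero (hE.genSecondForm_eq_zero hX hY)

theorem Metric.IsGeodesic.inner_leviCivita_of_perp (hE : g.IsGeodesic (g.perp E))
    (hX : E.IsSectionAt x X) (hY : (g.perp E).IsSectionAt x Y) (hZ : (g.perp E).IsSectionAt x Z) :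
    g.inner x (g.leviCivita Y x (X x)) (Z x) = d% (fun y ↦ g.inner y (Y y) (Z y)) x (X x) -
      g.inner x (Y x) (mlieBracket 𝓘(ℝ, V) X Z x) := by
  have hYX : g.inner x (Y x) (g.leviCivita X x (Z x)) = 0 := by
    rw [g.symm, g.inner_leviCivita_of_inner_eq_zero hZ.mdifferentiableAt hX.mdifferentiableAt
      hY.mdifferentiableAt, hE.leviCivita_mem hZ hY _ hX.mem, neg_zero]
    filter_upwards [hX.eventually_mem, hY.eventually_mem] with y hXy hYy using hYy _ hXy
  rw [g.leviCivita_metric hX.mdifferentiableAt hY.mdifferentiableAt hZ.mdifferentiableAt,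
    ← g.leviCivita_torsion hX.mdifferentiableAt hZ.mdifferentiableAt, map_sub, hYX]
  ring

end Gradient

section Nets

variable {V : Type*} [NormedAddCommGroup V] [NormedSpace ℝ V]
  {M : Type*} [TopologicalSpace M] [ChartedSpace V M] [IsManifold 𝓘(ℝ, V) ∞ M]
  {g : Metric V M} {k : ℕ} {E : Fin k → Distribution V M} {i j : Fin k} {x : M}
  {X Y Z : Π x : M, TangentSpace 𝓘(ℝ, V) x}

theorem IsLocallyDecomposable.mlieBracket_mem_sup [CompleteSpace V] (hE : IsLocallyDecomposable E)
    (htop : ⨆ i, E i x = ⊤) (hX : (E i).IsSectionAt x X) (hY : (E j).IsSectionAt x Y) :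
    mlieBracket 𝓘(ℝ, V) X Y x ∈ E i x ⊔ E j x := by
  obtain ⟨m, φ, S, hx, hφ, -, -, -, hmem⟩ := hE x
  have hsource := φ.open_source.mem_nhds hx
  refine mem_sup_of_apply_eq_zero
    (D := (mfderiv 𝓘(ℝ, V) 𝓘(ℝ, Π i, EuclideanSpace ℝ (Fin (m i))) φ x).toLinearMap)
    htop (fun l v ↦ hmem x hx l v) fun l hli hlj ↦ ?_
  ext a
  let L := (EuclideanSpace.proj a : EuclideanSpace ℝ (Fin (m l)) →L[ℝ] ℝ) ∘L
    ContinuousLinearMap.proj (R := ℝ) (φ := fun i ↦ EuclideanSpace ℝ (Fin (m i))) l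
  have hf : CMDiffAt ∞ (fun y ↦ L (φ y)) x :=
    L.contMDiff.contMDiffAt.comp x (hφ.contMDiffAt hsource)
  have hdL {y : M} (hy : y ∈ φ.source) (v : TangentSpace 𝓘(ℝ, V) y) :
      d% (fun y ↦ L (φ y)) y v =
        L (mfderiv 𝓘(ℝ, V) 𝓘(ℝ, Π i, EuclideanSpace ℝ (Fin (m i))) φ y v) :=
    mvfderiv_clm_comp_apply L
      ((hφ.contMDiffAt (φ.open_source.mem_nhds hy)).mdifferentiableAt (by simp)) v
  have hzero {n : Fin k} (hn : l ≠ n) {W : Π x : M, TangentSpace 𝓘(ℝ, V) x}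
      (hW : (E n).IsSectionAt x W) :
      (fun y ↦ d% (fun z ↦ L (φ z)) y (W y)) =ᶠ[𝓝 x] fun _ ↦ 0 := by
    filter_upwards [hsource, hW.eventually_mem] with y hy hWy
    rw [hdL hy]
    exact congrArg (EuclideanSpace.proj a) ((hmem y hy n _).1 hWy l hn)
  have hbracket := mvfderiv_mlieBracket_apply (hf.of_le ENat.LEInfty.out)
    (hX.contMDiffAt.of_le ENat.LEInfty.out) (hY.contMDiffAt.of_le ENat.LEInfty.out)
  rw [mvfderiv_congr (hzero hlj hY), mvfderiv_congr (hzero hli hX), hdL hx,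
    mvfderiv_const, zero_apply, zero_apply, sub_zero] at hbracket
  exact hbracket

namespace Metric.IsOrthogonallyIntegrable

theorem le_perp (hE : g.IsOrthogonallyIntegrable E) (hij : i ≠ j) : E j ≤ g.perp (E i) :=
  fun x w hw v hv ↦ hE.orthogonal i j hij x v hv w hw

theorem iSup_eq_top (hE : g.IsOrthogonallyIntegrable E) (x : M) : ⨆ i, E i x = ⊤ :=
  (hE.directSum x).submodule_iSup_eq_top

theorem eq_of_forall_inner_eq (hE : g.IsOrthogonallyIntegrable E)
    {v w : TangentSpace 𝓘(ℝ, V) x} (hv : v ∈ g.perp (E i) x) (hw : w ∈ g.perp (E i) x)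
    (h : ∀ j, i ≠ j → ∀ z ∈ E j x, g.inner x v z = g.inner x w z) : v = w := by
  refine sub_eq_zero.1 (g.nondegenerate x _ fun u ↦ ?_)
  have hu : u ∈ ⨆ j, E j x := hE.iSup_eq_top x ▸ trivial
  induction hu using Submodule.iSup_induction' with
  | mem j z hz =>
    rw [map_sub, sub_apply, sub_eq_zero]
    obtain rfl | hij := eq_or_ne i j
    · rw [g.symm, g.symm x w, hv z hz, hw z hz]
    · exact h j hij z hz
  | zero => exact map_zero _
  | add a b _ _ ha hb => rw [map_add, ha, hb, add_zero]

variable [FiniteDimensional ℝ V]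

theorem mlieBracket_mem_sup (hE : g.IsOrthogonallyIntegrable E) (hX : (E i).IsSectionAt x X)
    (hY : (E j).IsSectionAt x Y) : mlieBracket 𝓘(ℝ, V) X Y x ∈ E i x ⊔ E j x :=
  have : CompleteSpace V := FiniteDimensional.complete ℝ V
  hE.decomposable.mlieBracket_mem_sup (hE.iSup_eq_top x) hX hY

theorem inner_leviCivita_comm (hE : g.IsOrthogonallyIntegrable E) (hij : i ≠ j)
    (hX : (E i).IsSectionAt x X) (hY : (E i).IsSectionAt x Y) {z : TangentSpace 𝓘(ℝ, V) x}
    (hz : z ∈ E j x) :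
    g.inner x (g.leviCivita Y x (X x)) z = g.inner x (g.leviCivita X x (Y x)) z := by
  have hbracket := hE.mlieBracket_mem_sup hX hY
  rw [sup_idem, ← g.leviCivita_torsion hX.mdifferentiableAt hY.mdifferentiableAt] at hbracket
  have h := hE.orthogonal i j hij x _ hbracket z hz
  rwa [map_sub, sub_apply, sub_eq_zero] at h

theorem inner_leviCivita_swap (hE : g.IsOrthogonallyIntegrable E) (hij : i ≠ j)
    (hX : MDiffAt (T% X) x) (hY : (E i).IsSectionAt x Y) (hZ : (E j).IsSectionAt x Z) :
    g.inner x (g.leviCivita Z x (X x)) (Y x) = -g.inner x (g.leviCivita Y x (X x)) (Z x) := by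
  rw [g.inner_leviCivita_of_inner_eq_zero hX hZ.mdifferentiableAt hY.mdifferentiableAt, g.symm]
  filter_upwards [hY.eventually_mem, hZ.eventually_mem] with y hYy hZy
  exact hE.orthogonal j i hij.symm y _ hZy _ hYy

end Metric.IsOrthogonallyIntegrable

end Nets

section CyclicSum

variable {K W : Type*} [Field K] [CharZero K] [AddCommGroup W] [Module K W]

theorem eq_zero_of_cyclicSum_mul_eq_zero {B : LinearMap.BilinForm K W} (hB : B.Nondegenerate)
    (hsymm : B.IsSymm) {θ : Module.Dual K W}
    (h : ∀ u v w, θ u * B v w + θ v * B w u + θ w * B u v = 0) : θ = 0 := by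
  ext u
  by_contra hu
  have huu : B u u = 0 := by
    have h3 : (3 : K) * (θ u * B u u) = 0 := by linear_combination h u u u
    simpa [show θ u ≠ 0 from hu] using h3
  suffices ∀ v, B u v = 0 from hu (by rw [hB.1 u this, map_zero, LinearMap.zero_apply])
  intro v
  have h2 : (2 : K) * (θ u * B u v) = 0 := by
    have huv := h u u v
    rw [huu, hsymm.eq v u] at huv
    linear_combination huv
  simpa [show θ u ≠ 0 from hu] using h2

end CyclicSum

section ConformalKilling

variable {V : Type*} [NormedAddCommGroup V] [NormedSpace ℝ V]
  {M : Type*} [TopologicalSpace M] [ChartedSpace V M] [IsManifold 𝓘(ℝ, V) ∞ M]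
  {g : Metric V M} {x : M} {X Y Z t : Π x : M, TangentSpace 𝓘(ℝ, V) x}
  {T : Π x : M, TangentSpace 𝓘(ℝ, V) x →L[ℝ] TangentSpace 𝓘(ℝ, V) x}
  {E : Distribution V M}

theorem Metric.IsNondegenerate.exists_inner_ne_zero (hE : g.IsNondegenerate E) (hbot : E x ≠ ⊥) :
    ∃ v ∈ E x, ∃ w ∈ E x, g.inner x v w ≠ 0 := by
  by_contra! h
  exact hbot ((Submodule.eq_bot_iff _).2 fun v hv ↦ hE x v hv (h v hv))

theorem Metric.IsSymmetricTensor.contMDiffAt_apply (hT : g.IsSymmetricTensor T)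
    (hX : CMDiffAt ∞ (T% X) x) : CMDiffAt ∞ (T% fun y ↦ T y (X y)) x :=
  ContMDiffAt.clm_bundle_apply (F₁ := V) (F₂ := V) (hT.smooth x) hX

variable [FiniteDimensional ℝ V]

/-- The vector field `t` is a conformal factor of `T`, that is `∇_{(i} T_{jk)} = t_{(i} g_{jk)}`,
the identity at `x` being tested on vector fields that are smooth near `x`. -/
def Metric.IsConformalFactor (g : Metric V M)
    (T : Π x : M, TangentSpace 𝓘(ℝ, V) x →L[ℝ] TangentSpace 𝓘(ℝ, V) x)
    (t : Π x : M, TangentSpace 𝓘(ℝ, V) x) : Prop :=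
  ∀ (x : M) (X Y Z : Π x : M, TangentSpace 𝓘(ℝ, V) x), (⊤ : Distribution V M).IsSectionAt x X →
    (⊤ : Distribution V M).IsSectionAt x Y → (⊤ : Distribution V M).IsSectionAt x Z →
      g.covDerivTensor T X Y Z x + g.covDerivTensor T Y Z X x + g.covDerivTensor T Z X Y x =
        g.inner x (t x) (X x) * g.inner x (Y x) (Z x)
          + g.inner x (t x) (Y x) * g.inner x (Z x) (X x)
          + g.inner x (t x) (Z x) * g.inner x (X x) (Y x)

theorem Metric.IsConformalKilling.exists_isConformalFactor (hT : g.IsConformalKilling T) :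
    ∃ t, g.IsConformalFactor T t := by
  obtain ⟨t, -, ht⟩ := hT.exists_conformalFactor
  refine ⟨t, fun x X Y Z hX hY hZ ↦ ?_⟩
  obtain ⟨U, hU, hxU, hXU⟩ := hX.exists_isSectionOn
  obtain ⟨U', hU', hxU', hYU'⟩ := hY.exists_isSectionOn
  obtain ⟨U'', hU'', hxU'', hZU''⟩ := hZ.exists_isSectionOn
  exact ht (U ∩ (U' ∩ U'')) X Y Z (hU.inter (hU'.inter hU''))
    (hXU.smooth.mono Set.inter_subset_left)
    (hYU'.smooth.mono (Set.inter_subset_right.trans Set.inter_subset_left))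
    (hZU''.smooth.mono (Set.inter_subset_right.trans Set.inter_subset_right)) x ⟨hxU, hxU', hxU''⟩

namespace Metric.IsConformalKillingNet

variable {k : ℕ} {lam : Fin k → M → ℝ} {E : Fin k → Distribution V M} {i j : Fin k}

theorem exists_isSectionAt (hE : g.IsConformalKillingNet T lam E) {v : TangentSpace 𝓘(ℝ, V) x}
    (hv : v ∈ E i x) : ∃ X, (E i).IsSectionAt x X ∧ X x = v :=
  (hE.orthogonallyIntegrable.nondegenerate i).exists_isSectionAt
    (hE.orthogonallyIntegrable.smooth i) hv

theorem exists_isSectionAt_inner_ne_zero (hE : g.IsConformalKillingNet T lam E) (i : Fin k)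
    (x : M) : ∃ X Y, (E i).IsSectionAt x X ∧ (E i).IsSectionAt x Y ∧
      g.inner x (X x) (Y x) ≠ 0 := by
  obtain ⟨v, hv, w, hw, hvw⟩ :=
    (hE.orthogonallyIntegrable.nondegenerate i).exists_inner_ne_zero (hE.ne_bot i x)
  obtain ⟨X, hX, rfl⟩ := hE.exists_isSectionAt hv
  obtain ⟨Y, hY, rfl⟩ := hE.exists_isSectionAt hw
  exact ⟨X, Y, hX, hY, hvw⟩

theorem contMDiff_eigenfunction (hE : g.IsConformalKillingNet T lam E) (i : Fin k) :
    CMDiff ∞ (lam i) := by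
  intro x
  obtain ⟨X, Y, hX, hY, hXY⟩ := hE.exists_isSectionAt_inner_ne_zero i x
  have hsmooth := g.contMDiffAt_inner hX.contMDiffAt hY.contMDiffAt
  have hT := g.contMDiffAt_inner
    (hE.conformalKilling.symmetricTensor.contMDiffAt_apply hX.contMDiffAt) hY.contMDiffAt
  refine (hT.div₀ hsmooth hXY).congr_of_eventuallyEq ?_
  filter_upwards [hX.eventually_mem, hsmooth.continuousAt.eventually_ne hXY] with y hXy hXYy
  rw [Pi.div_apply, (hE.mem_iff i y _).1 hXy, map_smul, smul_apply, smul_eq_mul,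
    mul_div_cancel_right₀ _ hXYy]

theorem mdifferentiableAt_eigenfunction (hE : g.IsConformalKillingNet T lam E) (i : Fin k)
    (x : M) : MDiffAt (lam i) x :=
  (hE.contMDiff_eigenfunction i x).mdifferentiableAt (by simp)

theorem covDerivTensor_eq (hE : g.IsConformalKillingNet T lam E)
    (hY : (E i).IsSectionAt x Y) (hZ : Z x ∈ E j x) :
    g.covDerivTensor T X Y Z x = d% (lam i) x (X x) * g.inner x (Y x) (Z x) +
      (lam i x - lam j x) * g.inner x (g.leviCivita Y x (X x)) (Z x) := by
  have hlam := hE.mdifferentiableAt_eigenfunction i x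
  have hT := hE.conformalKilling.symmetricTensor
  have hTY : ∀ᶠ y in 𝓝 x, T y (Y y) = (lam i • Y) y :=
    hY.eventually_mem.mono fun y hy ↦ (hE.mem_iff i y _).1 hy
  have hderiv : g.leviCivita (fun y ↦ T y (Y y)) x =
      lam i x • g.leviCivita Y x + (d% (lam i) x).smulRight (Y x) :=
    (g.leviCivita.isCovariantDerivativeOn.congr_of_eventuallyEq
      ((hT.contMDiffAt_apply hY.contMDiffAt).mdifferentiableAt (by simp))
      (hlam.smul_section hY.mdifferentiableAt) univ_mem hTY).trans
      (g.leviCivita.isCovariantDerivativeOnUniv.leibniz hY.mdifferentiableAt hlam)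
  rw [Metric.covDerivTensor, hderiv, map_sub, sub_apply, hT.symm, (hE.mem_iff j x _).1 hZ]
  simp only [add_apply, smul_apply, ContinuousLinearMap.smulRight_apply, map_add, map_smul,
    smul_eq_mul]
  ring

theorem mvfderiv_eigenfunction_eq (hE : g.IsConformalKillingNet T lam E)
    (ht : g.IsConformalFactor T t) {v : TangentSpace 𝓘(ℝ, V) x} (hv : v ∈ E i x) :
    d% (lam i) x v = g.inner x (t x) v := by
  have hθ := eq_zero_of_cyclicSum_mul_eq_zero
    (θ := (d% (lam i) x - g.inner x (t x)).toLinearMap.domRestrict (E i x))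
    ((hE.orthogonallyIntegrable.nondegenerate i).nondegenerate_restrict x)
    ⟨fun v w ↦ g.symm x v w⟩ fun u v w ↦ ?_
  · exact sub_eq_zero.1 (congrArg (fun φ ↦ φ ⟨v, hv⟩) hθ)
  obtain ⟨X, hX, hXu⟩ := hE.exists_isSectionAt u.2
  obtain ⟨Y, hY, hYv⟩ := hE.exists_isSectionAt v.2
  obtain ⟨Z, hZ, hZw⟩ := hE.exists_isSectionAt w.2
  have hcyclic := ht x X Y Z (hX.mono le_top) (hY.mono le_top) (hZ.mono le_top)
  rw [hE.covDerivTensor_eq hY hZ.mem, hE.covDerivTensor_eq hZ hX.mem,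
    hE.covDerivTensor_eq hX hY.mem, hXu, hYv, hZw] at hcyclic
  change (d% (lam i) x u - g.inner x (t x) u) * g.inner x v w +
    (d% (lam i) x v - g.inner x (t x) v) * g.inner x w u +
    (d% (lam i) x w - g.inner x (t x) w) * g.inner x u v = 0
  linear_combination hcyclic

theorem two_mul_sub_mul_inner_leviCivita (hE : g.IsConformalKillingNet T lam E) (hij : i ≠ j)
    (hX : (E i).IsSectionAt x X) (hY : (E i).IsSectionAt x Y) (hZ : (E j).IsSectionAt x Z) :
    2 * (lam i x - lam j x) * g.inner x (g.leviCivita Y x (X x)) (Z x) =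
      (d% (lam j) x (Z x) - d% (lam i) x (Z x)) * g.inner x (X x) (Y x) := by
  obtain ⟨t, ht⟩ := hE.conformalKilling.exists_isConformalFactor
  have hO := hE.orthogonallyIntegrable
  have hcyclic := ht x X Y Z (hX.mono le_top) (hY.mono le_top) (hZ.mono le_top)
  rw [hE.covDerivTensor_eq hY hZ.mem, hE.covDerivTensor_eq hZ hX.mem,
    hE.covDerivTensor_eq hX hY.mem, hO.inner_leviCivita_swap hij hY.mdifferentiableAt hX hZ,
    hO.inner_leviCivita_comm hij hY hX hZ.mem, hO.orthogonal i j hij x _ hY.mem _ hZ.mem,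
    hO.orthogonal j i hij.symm x _ hZ.mem _ hX.mem, ← hE.mvfderiv_eigenfunction_eq ht hZ.mem]
    at hcyclic
  linear_combination hcyclic

end Metric.IsConformalKillingNet

end ConformalKilling

section LogGap

/-- The function `-log √|λᵢ - λⱼ|`, whose gradient has the `Eⱼ`-component of the mean curvature
normal of the eigendistribution `Eᵢ`. The absolute value is built into `Real.log`. -/
noncomputable def logGap {ι M : Type*} (lam : ι → M → ℝ) (i j : ι) (x : M) : ℝ :=
  -(1 / 2) * Real.log (lam i x - lam j x)

theorem logGap_comm {ι M : Type*} (lam : ι → M → ℝ) (i j : ι) :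
    logGap lam i j = logGap lam j i := by
  ext x
  rw [logGap, logGap, ← Real.log_neg_eq_log, neg_sub]

variable {V : Type*} [NormedAddCommGroup V] [NormedSpace ℝ V]
  {M : Type*} [TopologicalSpace M] [ChartedSpace V M]
  {ι : Type*} {lam : ι → M → ℝ} {i j : ι} {x : M}

theorem contMDiffAt_logGap {n : WithTop ℕ∞} (hi : CMDiffAt n (lam i) x)
    (hj : CMDiffAt n (lam j) x) (hij : lam i x ≠ lam j x) : CMDiffAt n (logGap lam i j) x :=
  contMDiffAt_const.mul <|
    (Real.contDiffAt_log.2 (sub_ne_zero.2 hij)).contMDiffAt.comp x (hi.sub hj)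

theorem mvfderiv_logGap_apply (hi : MDiffAt (lam i) x) (hj : MDiffAt (lam j) x)
    (hij : lam i x ≠ lam j x) (v : TangentSpace 𝓘(ℝ, V) x) :
    2 * (lam i x - lam j x) * d% (logGap lam i j) x v = d% (lam j) x v - d% (lam i) x v := by
  have hsub := sub_ne_zero.2 hij
  have h : d% (logGap lam i j) x = _ :=
    mvfderiv_comp_of_hasDerivAt (f := lam i - lam j)
      ((Real.hasDerivAt_log hsub).const_mul (-(1 / 2))) (hi.sub hj)
  rw [h, mvfderiv_sub hi hj, smul_apply, sub_apply, smul_eq_mul]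
  field_simp
  ring

end LogGap

section Net

variable {V : Type*} [NormedAddCommGroup V] [NormedSpace ℝ V] [FiniteDimensional ℝ V]
  {M : Type*} [TopologicalSpace M] [ChartedSpace V M] [IsManifold 𝓘(ℝ, V) ∞ M]
  {g : Metric V M} {k : ℕ}
  {T : Π x : M, TangentSpace 𝓘(ℝ, V) x →L[ℝ] TangentSpace 𝓘(ℝ, V) x}
  {lam : Fin k → M → ℝ} {E : Fin k → Distribution V M} {i j : Fin k}
  {x : M} {X Y Z : Π x : M, TangentSpace 𝓘(ℝ, V) x}

/-- The candidate for the mean curvature normal of the `i`-th eigendistribution of a conformal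
Killing tensor: the field orthogonal to `E i` whose `E j`-component, for `j ≠ i`, is that of the
gradient of `-log √|λᵢ - λⱼ|`. -/
noncomputable def Metric.logGapNormal (g : Metric V M) (lam : Fin k → M → ℝ)
    (E : Fin k → Distribution V M) (i : Fin k) (x : M) : TangentSpace 𝓘(ℝ, V) x :=
  ∑ j ∈ Finset.univ.erase i, g.tangentPart (E j) x (g.gradient (logGap lam i j) x)

namespace Metric.IsOrthogonallyIntegrable

theorem logGapNormal_mem_perp (hE : g.IsOrthogonallyIntegrable E) :
    g.logGapNormal lam E i x ∈ g.perp (E i) x :=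
  Submodule.sum_mem _ fun _ hj ↦ hE.le_perp (Finset.ne_of_mem_erase hj).symm x (g.tangentPart_mem _)

theorem inner_logGapNormal (hE : g.IsOrthogonallyIntegrable E) (hij : i ≠ j)
    {z : TangentSpace 𝓘(ℝ, V) x} (hz : z ∈ E j x) :
    g.inner x (g.logGapNormal lam E i x) z = d% (logGap lam i j) x z := by
  rw [Metric.logGapNormal, map_sum, sum_apply, Finset.sum_eq_single_of_mem j (by simp [hij.symm])
    fun l _ hl ↦ hE.orthogonal l j hl x _ (g.tangentPart_mem _) z hz,
    (hE.nondegenerate j).inner_tangentPart_left hz, g.inner_gradient]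

end Metric.IsOrthogonallyIntegrable

namespace Metric.IsConformalKillingNet

theorem contMDiff_logGap (hE : g.IsConformalKillingNet T lam E) (hij : i ≠ j) :
    CMDiff ∞ (logGap lam i j) := fun x ↦
  contMDiffAt_logGap (hE.contMDiff_eigenfunction i x) (hE.contMDiff_eigenfunction j x)
    (hE.distinct i j hij x)

theorem isSectionAt_logGapNormal (hE : g.IsConformalKillingNet T lam E) (i : Fin k) (x : M) :
    (g.perp (E i)).IsSectionAt x (g.logGapNormal lam E i) := by
  have hO := hE.orthogonallyIntegrable
  refine .of_forall fun y ↦ ⟨ContMDiffAt.sum_section fun j hj ↦ ?_, hO.logGapNormal_mem_perp⟩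
  exact (hO.nondegenerate j).contMDiffAt_tangentPart (hO.smooth j)
    (g.contMDiffAt_gradient (hE.contMDiff_logGap (Finset.ne_of_mem_erase hj).symm y))

theorem inner_leviCivita_eq (hE : g.IsConformalKillingNet T lam E) (hij : i ≠ j)
    (hX : (E i).IsSectionAt x X) (hY : (E i).IsSectionAt x Y) (hZ : (E j).IsSectionAt x Z) :
    g.inner x (g.leviCivita Y x (X x)) (Z x) =
      g.inner x (X x) (Y x) * d% (logGap lam i j) x (Z x) := by
  have hne := hE.distinct i j hij x
  have hgap := mvfderiv_logGap_apply (hE.mdifferentiableAt_eigenfunction i x)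
    (hE.mdifferentiableAt_eigenfunction j x) hne (Z x)
  refine mul_left_cancel₀ (mul_ne_zero two_ne_zero (sub_ne_zero.2 hne)) ?_
  linear_combination hE.two_mul_sub_mul_inner_leviCivita hij hX hY hZ - g.inner x (X x) (Y x) * hgap

theorem genSecondForm_eq (hE : g.IsConformalKillingNet T lam E) (hX : (E i).IsSectionAt x X)
    (hY : (E i).IsSectionAt x Y) :
    g.genSecondForm (E i) X Y x = g.inner x (X x) (Y x) • g.logGapNormal lam E i x := by
  have hO := hE.orthogonallyIntegrable
  refine hO.eq_of_forall_inner_eq ((hO.nondegenerate i).normalPart_mem_perp _)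
    (Submodule.smul_mem _ _ hO.logGapNormal_mem_perp) fun j hij z hz ↦ ?_
  obtain ⟨Z, hZ, rfl⟩ := hE.exists_isSectionAt hz
  rw [Metric.genSecondForm, g.inner_normalPart_left (hO.le_perp hij x hz),
    hE.inner_leviCivita_eq hij hX hY hZ, map_smul, smul_apply, hO.inner_logGapNormal hij hz,
    smul_eq_mul]

theorem meanCurvature_eq (hE : g.IsConformalKillingNet T lam E) (i : Fin k) :
    g.meanCurvature (E i) = g.logGapNormal lam E i :=
  funext fun x ↦ (hE.orthogonallyIntegrable.nondegenerate i).meanCurvature_eq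
    (hE.orthogonallyIntegrable.smooth i) (hE.ne_bot i x) fun _ _ ↦ hE.genSecondForm_eq

theorem isUmbilical (hE : g.IsConformalKillingNet T lam E) (i : Fin k) : g.IsUmbilical (E i) := by
  intro U X Y hU hX hY x hx
  rw [hE.meanCurvature_eq]
  exact hE.genSecondForm_eq (hX.isSectionAt hU hx) (hY.isSectionAt hU hx)

theorem mvfderiv_logGap_eq_zero (hE : g.IsConformalKillingNet T lam E)
    (hi : g.IsGeodesic (g.perp (E i))) (hij : i ≠ j) {v : TangentSpace 𝓘(ℝ, V) x}
    (hv : v ∈ E i x) : d% (logGap lam i j) x v = 0 := by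
  have hle := hE.orthogonallyIntegrable.le_perp hij
  obtain ⟨X, hX, rfl⟩ := hE.exists_isSectionAt hv
  obtain ⟨Y, Z, hY, hZ, hYZ⟩ := hE.exists_isSectionAt_inner_ne_zero j x
  have hinner := hE.inner_leviCivita_eq hij.symm hY hZ hX
  rw [g.symm, hi.leviCivita_mem (hY.mono hle) (hZ.mono hle) _ hv, logGap_comm] at hinner
  exact (mul_eq_zero.1 hinner.symm).resolve_left hYZ

theorem inner_logGapNormal_of_mem_sup (hE : g.IsConformalKillingNet T lam E)
    (hi : g.IsGeodesic (g.perp (E i))) (hij : i ≠ j) {w : TangentSpace 𝓘(ℝ, V) x}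
    (hw : w ∈ E i x ⊔ E j x) :
    g.inner x (g.logGapNormal lam E i x) w = d% (logGap lam i j) x w := by
  have hO := hE.orthogonallyIntegrable
  obtain ⟨v, hv, z, hz, rfl⟩ := Submodule.mem_sup.1 hw
  rw [map_add, map_add, g.symm, hO.logGapNormal_mem_perp v hv, hE.mvfderiv_logGap_eq_zero hi hij hv,
    hO.inner_logGapNormal hij hz]

theorem normalPart_leviCivita_logGapNormal (hE : g.IsConformalKillingNet T lam E)
    (hi : g.IsGeodesic (g.perp (E i))) (hX : (E i).IsSectionAt x X) :
    g.normalPart (E i) x (g.leviCivita (g.logGapNormal lam E i) x (X x)) = 0 := by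
  have hO := hE.orthogonallyIntegrable
  refine hO.eq_of_forall_inner_eq ((hO.nondegenerate i).normalPart_mem_perp _)
    (Submodule.zero_mem _) fun j hij z hz ↦ ?_
  obtain ⟨Z, hZ, rfl⟩ := hE.exists_isSectionAt hz
  have hNZ : (fun y ↦ g.inner y (g.logGapNormal lam E i y) (Z y)) =ᶠ[𝓝 x]
      fun y ↦ d% (logGap lam i j) y (Z y) :=
    hZ.eventually_mem.mono fun y hy ↦ hO.inner_logGapNormal hij hy
  have hdX : (fun y ↦ d% (logGap lam i j) y (X y)) =ᶠ[𝓝 x] fun _ ↦ 0 :=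
    hX.eventually_mem.mono fun y hy ↦ hE.mvfderiv_logGap_eq_zero hi hij hy
  have hbracket := mvfderiv_mlieBracket_apply ((hE.contMDiff_logGap hij x).of_le ENat.LEInfty.out)
    (hX.contMDiffAt.of_le ENat.LEInfty.out) (hZ.contMDiffAt.of_le ENat.LEInfty.out)
  rw [mvfderiv_congr hdX, mvfderiv_const, zero_apply, sub_zero] at hbracket
  rw [g.inner_normalPart_left (hO.le_perp hij x hz),
    hi.inner_leviCivita_of_perp hX (hE.isSectionAt_logGapNormal i x) (hZ.mono (hO.le_perp hij)),
    hE.inner_logGapNormal_of_mem_sup hi hij (hO.mlieBracket_mem_sup hX hZ), mvfderiv_congr hNZ,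
    hbracket, sub_self, map_zero, zero_apply]

theorem isSpherical (hE : g.IsConformalKillingNet T lam E) (hi : g.IsGeodesic (g.perp (E i))) :
    g.IsSpherical (E i) where
  umbilical := hE.isUmbilical i
  smooth_meanCurvature := by
    rw [hE.meanCurvature_eq]
    exact fun x ↦ (hE.isSectionAt_logGapNormal i x).contMDiffAt
  parallel U X hU hX x hx := by
    rw [hE.meanCurvature_eq]
    exact hE.normalPart_leviCivita_logGapNormal hi (hX.isSectionAt hU hx)

end Metric.IsConformalKillingNet

end Net

end PseudoRiemannian

theorem mainTheorem7
    {V : Type*} [NormedAddCommGroup V] [NormedSpace ℝ V] [FiniteDimensional ℝ V]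
    {M : Type*} [TopologicalSpace M] [ChartedSpace V M] [IsManifold 𝓘(ℝ, V) ∞ M]
    (g : PseudoRiemannian.Metric V M) {k : ℕ}
    (T : Π x : M, TangentSpace 𝓘(ℝ, V) x →L[ℝ] TangentSpace 𝓘(ℝ, V) x)
    (lam : Fin k → M → ℝ) (E : Fin k → PseudoRiemannian.Distribution V M)
    (hE : g.IsConformalKillingNet T lam E)
    (i : Fin k) (hi : g.IsGeodesic (g.perp (E i))) :
    g.IsSpherical (E i) ∧ g.IsKilling (E i) :=
  have hspherical := hE.isSpherical hi
  ⟨hspherical, hspherical, hi⟩
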